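/- **Corollary (CDF of the $n$-th dominant interference power).** Let $\Phi=\{x_i\}$ be a homogeneous Poisson point process on $\mathbb{R}^2$ with intensity $\lambda>0$, let $\alpha>2$ and $0<\phi\le 2\pi$, and let the channel gains $h_i$ be i.i.d., almost surely positive random variables, independent of $(x_i)$, with $\bar h_{2/\alpha}:=E[h^{2/\alpha}]<\infty$. A receiver at $x\in\mathbb{R}^2$ receives the power $h_i\|x-x_i\|^{-\alpha}$ from node $i$; its interferers are the nodes $x_i$ for which the angle in $[0,2\pi)$ of the vector $x_i-x$ with the horizontal axis is at most $\phi$. For $z\ge 0$ let $N_z$ be the number of points in $[0,z]$ of the transformed process $\Phi_2=\{\|x_i-x\|^{\alpha}/h_i : x_i \text{ an interferer}\}$, and let $\Lambda_2(z)=E[N_z]$. Then: 1. almost surely, the powers received from the interferers can be arranged into a strictly decreasing sequence $I_1>I_2>\cdots$ in which every interferer occurs exactly once ($I_n$ is the $n$-th dominant interference power); 2. for all $z\ge 0$, $\Lambda_2(z)=\frac{\phi\lambda}{2}\,\bar h_{2/\alpha}\,z^{2/\alpha}$, and $N_z$ is a Poisson random variable with mean $\Lambda_2(z)$; 3. for every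 $n\ge 1$, $I_n$ is a random variable with the CDF $$F_{I_n}(z)=P(I_n\le z)=\frac{\Gamma\left(n,\Lambda_2(z^{-1})\right)}{\Gamma(n)}\quad (z>0),\qquad F_{I_n}(z)=0\quad (z\le 0),$$ where $\Gamma(a,b)=\int_b^\infty t^{a-1}e^{-t}\,dt$ is the upper incomplete gamma function. -/

import Mathlib

open MeasureTheory ProbabilityTheory

noncomputable section

namespace Interference

/-- The Euclidean plane. -/
abbrev Plane : Type := EuclideanSpace ℝ (Fin 2)

/-- Number of indices `i` with `x i ∈ B`: the number of points, counted with multiplicity, that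
the point pattern `{x i}` has in `B`. -/
def pointCount {E : Type*} (x : ℕ → E) (B : Set E) : ℕ∞ :=
  {i : ℕ | x i ∈ B}.encard

/-- The random points `x 0, x 1, …` enumerate a homogeneous Poisson point process on the plane
with intensity `lam` per unit area: the number of points in a Borel set `B` of finite area is
Poisson with mean `lam * area B`, and the numbers of points in pairwise disjoint such sets are
independent. (For `lam > 0` the process has infinitely many points almost surely, so that an
enumeration by `ℕ` is no restriction.) -/
structure IsHomogeneousPPP {Ω : Type*} [MeasurableSpace Ω] (P : Measure Ω) (lam : ℝ)
    (x : ℕ → Ω → Plane) : Prop where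
  measurable : ∀ i, Measurable (x i)
  count_law : ∀ B : Set Plane, MeasurableSet B → volume B ≠ ⊤ → ∀ k : ℕ,
    P {ω | pointCount (fun i => x i ω) B = k} =
      poissonMeasure (Real.toNNReal (lam * (volume B).toReal)) {k}
  count_indep : ∀ (m : ℕ) (B : Fin m → Set Plane), (∀ j, MeasurableSet (B j)) →
    (∀ j, volume (B j) ≠ ⊤) → Pairwise (fun j l => Disjoint (B j) (B l)) →
    iIndepFun (fun j ω => pointCount (fun i => x i ω) (B j)) P

/-- The angle in `[0, 2π)` of a plane vector, measured from the horizontal axis. -/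
def planeAngle (v : Plane) : ℝ :=
  toIcoMod Real.two_pi_pos 0 (Complex.arg ⟨v 0, v 1⟩)

/-- Indices of the interferers of a receiver at `r` with reception angle `φ`: the nodes seen from
`r` at an angle at most `φ`. -/
def interferers (r : Plane) (φ : ℝ) (x : ℕ → Plane) : Set ℕ :=
  {i | planeAngle (x i - r) ≤ φ}

/-- Interference power `h ‖r - y‖ ^ (-α)` received at `r` from a node at `y` with channel
gain `h`. -/
def power (α : ℝ) (r y : Plane) (h : ℝ) : ℝ :=
  h * ‖r - y‖ ^ (-α)

/-- The `n`-th dominant interference power (`n ≥ 1`): the `n`-th largest, counted with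
multiplicity, of the powers received from the interferers, that is, the largest `t` such that at
least `n` interferers have power at least `t`. -/
def nthDominant (α φ : ℝ) (r : Plane) (x : ℕ → Plane) (h : ℕ → ℝ) (n : ℕ) : ℝ :=
  sSup {t : ℝ | (n : ℕ∞) ≤ {i | i ∈ interferers r φ x ∧ t ≤ power α r (x i) (h i)}.encard}

/-- `I 1 > I 2 > …` is the arrangement in descending order of the family of powers received from
the interferers, every interferer occurring exactly once. -/
def IsDescendingArrangement (α φ : ℝ) (r : Plane) (x : ℕ → Plane) (h : ℕ → ℝ) (I : ℕ → ℝ) :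
    Prop :=
  StrictAnti (fun n : ℕ => I (n + 1)) ∧
    ∃ s : ℕ → ℕ, Set.BijOn s Set.univ (interferers r φ x) ∧
      ∀ n : ℕ, I (n + 1) = power α r (x (s n)) (h (s n))

/-- The number `N_z` of points in `[0, z]` of the transformed process
`{‖x i - r‖ ^ α / h i : i an interferer}` on the power axis. -/
def transformedCount (α φ : ℝ) (r : Plane) (x : ℕ → Plane) (h : ℕ → ℝ) (z : ℝ) : ℕ∞ :=
  {i | i ∈ interferers r φ x ∧ ‖x i - r‖ ^ α / h i ∈ Set.Icc 0 z}.encard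

/-- The intensity measure `Λ₂(z) = E[N_z]` of `[0, z]` under the transformed process. -/
def transformedIntensity {Ω : Type*} [MeasurableSpace Ω] (P : Measure Ω) (α φ : ℝ) (r : Plane)
    (x : ℕ → Ω → Plane) (h : ℕ → Ω → ℝ) (z : ℝ) : ENNReal :=
  ∫⁻ ω, (transformedCount α φ r (fun i => x i ω) (fun i => h i ω) z : ENNReal) ∂P

/-- The upper incomplete gamma function `Γ(a, b) = ∫_b^∞ t ^ (a - 1) e ^ (-t) dt`. -/
def upperGamma (a b : ℝ) : ℝ :=
  ∫ t in Set.Ioi b, t ^ (a - 1) * Real.exp (-t)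

end Interference

end

namespace Interference

open Filter
open scoped ENNReal NNReal Topology

/-! The marked points `(x i, h i)` behave like a Poisson process on `Plane × ℝ` with intensity `lam`
times area times the law of `h 0`. Only the law of a single count is needed, and
`IsMarkedPPP.count_law` provides it: independence lets the i.i.d. marks be integrated out one factor
at a time, which turns the generating function of the count into the generating functional of the
unmarked process (`lintegral_iInf_prod`); the result is the Poisson generating function, and power
series coefficients are unique.

`N_z` counts the marked points in one set. Its slice at mark `t` is a sector of radius `(z t)^(1/α)`
and area `φ/2 (z t)^(2/α)`; integrating over the mark gives `Λ₂(z)` (`prod_transformedSet_Icc`).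

Almost surely the configuration is regular (`ae_isRegular`). Each `N_z` is finite; there are
infinitely many interferers because `Λ₂(z) → ∞`; there are no ties because, among `n` cells of equal
mean `m/n`, some cell holds two points with probability at most `n (m/n)²`. No density of the gains
is required. A regular family can be sorted, and then `I_n < t` exactly when `N_{1/t} < n`. The
Poisson sum for `P(N < n)` is the quotient of gamma functions, and continuity in `t` passes from `<`
to `≤`. -/

/-! ### Poisson laws for counts with values in `ℕ∞` -/

theorem map_eq_map_poissonMeasure {Ω : Type*} [MeasurableSpace Ω] {P : Measure Ω}
    [IsProbabilityMeasure P] {N : Ω → ℕ∞} (hN : Measurable N) {r : ℝ≥0}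
    (h : ∀ k : ℕ, P {ω | N ω = k} = poissonMeasure r {k}) :
    P.map N = (poissonMeasure r).map (Nat.cast : ℕ → ℕ∞) := by
  have hc : Measurable (Nat.cast : ℕ → ℕ∞) := .of_discrete
  have := Measure.isProbabilityMeasure_map (μ := P) hN.aemeasurable
  have := Measure.isProbabilityMeasure_map (μ := poissonMeasure r) hc.aemeasurable
  have hfin : ∀ k : ℕ, P.map N {(k : ℕ∞)} = (poissonMeasure r).map (Nat.cast : ℕ → ℕ∞) {(k : ℕ∞)} := by
    intro k
    rw [Measure.map_apply hN (measurableSet_singleton _),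
      Measure.map_apply hc (measurableSet_singleton _)]
    have e : (Nat.cast : ℕ → ℕ∞) ⁻¹' {(k : ℕ∞)} = {k} := by ext; simp
    rw [e, ← h k]
    rfl
  -- The finite values already carry total mass one, which forces the mass at `⊤` to vanish.
  have hr : (Set.range (Nat.cast : ℕ → ℕ∞))ᶜ = {⊤} := by
    ext a
    induction a using ENat.recTopCoe <;> simp
  have hrange : P.map N (Set.range (Nat.cast : ℕ → ℕ∞)) =
      (poissonMeasure r).map (Nat.cast : ℕ → ℕ∞) (Set.range (Nat.cast : ℕ → ℕ∞)) := by
    have e : Set.range (Nat.cast : ℕ → ℕ∞) = ⋃ k : ℕ, {(k : ℕ∞)} := by ext; simp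
    have hd : Pairwise (Function.onFun Disjoint fun k : ℕ => ({(k : ℕ∞)} : Set ℕ∞)) := by
      intro i j hij
      simpa using hij
    rw [e, measure_iUnion hd fun _ => measurableSet_singleton _,
      measure_iUnion hd fun _ => measurableSet_singleton _]
    exact tsum_congr hfin
  refine Measure.ext_of_singleton fun a => ?_
  induction a using ENat.recTopCoe with
  | coe k => exact hfin k
  | top =>
    rw [← hr, measure_compl .of_discrete (measure_ne_top _ _),
      measure_compl .of_discrete (measure_ne_top _ _), hrange]
    simp

theorem ae_ne_top_of_poisson {Ω : Type*} [MeasurableSpace Ω] {P : Measure Ω}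
    [IsProbabilityMeasure P] {N : Ω → ℕ∞} (hN : Measurable N) {r : ℝ≥0}
    (h : ∀ k : ℕ, P {ω | N ω = k} = poissonMeasure r {k}) : ∀ᵐ ω ∂P, N ω ≠ ⊤ := by
  have e : P (N ⁻¹' {⊤}) = 0 := by
    rw [← Measure.map_apply hN (measurableSet_singleton _), map_eq_map_poissonMeasure hN h,
      Measure.map_apply .of_discrete (measurableSet_singleton _)]
    simp [Set.preimage]
  rw [ae_iff]
  simpa [Set.preimage] using e

theorem lintegral_poissonMeasure (r : ℝ≥0) (f : ℕ → ℝ≥0∞) :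
    ∫⁻ k, f k ∂poissonMeasure r =
      ∑' k, f k * ENNReal.ofReal (Real.exp (-r) * r ^ k / k.factorial) := by
  rw [lintegral_countable']
  simp_rw [poissonMeasure_singleton]

theorem lintegral_comp_of_poisson {Ω : Type*} [MeasurableSpace Ω] {P : Measure Ω}
    [IsProbabilityMeasure P] {N : Ω → ℕ∞} (hN : Measurable N) {r : ℝ≥0}
    (h : ∀ k : ℕ, P {ω | N ω = k} = poissonMeasure r {k}) (f : ℕ∞ → ℝ≥0∞) :
    ∫⁻ ω, f (N ω) ∂P = ∫⁻ k : ℕ, f k ∂poissonMeasure r := by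
  rw [← lintegral_map (f := f) .of_discrete hN, map_eq_map_poissonMeasure hN h,
    lintegral_map .of_discrete .of_discrete]

theorem measure_preimage_of_poisson {Ω : Type*} [MeasurableSpace Ω] {P : Measure Ω}
    [IsProbabilityMeasure P] {N : Ω → ℕ∞} (hN : Measurable N) {r : ℝ≥0}
    (h : ∀ k : ℕ, P {ω | N ω = k} = poissonMeasure r {k}) (s : Set ℕ∞) :
    P (N ⁻¹' s) = poissonMeasure r {k : ℕ | (k : ℕ∞) ∈ s} := by
  rw [← Measure.map_apply hN .of_discrete, map_eq_map_poissonMeasure hN h,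
    Measure.map_apply .of_discrete .of_discrete]
  rfl

theorem hasSum_pow_mul_poisson (r : ℝ) (u : ℝ) :
    HasSum (fun k : ℕ => u ^ k * (Real.exp (-r) * r ^ k / k.factorial))
      (Real.exp (-(r * (1 - u)))) := by
  have h := (NormedSpace.expSeries_div_hasSum_exp (u * r)).mul_left (Real.exp (-r))
  rw [← Real.exp_eq_exp_ℝ, ← Real.exp_add] at h
  rw [show -(r * (1 - u)) = -r + u * r by ring]
  refine h.congr_fun fun k => ?_
  ring

theorem lintegral_pow_poissonMeasure (r : ℝ≥0) {u : ℝ} (hu : 0 ≤ u) :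
    ∫⁻ k, ENNReal.ofReal u ^ k ∂poissonMeasure r =
      ENNReal.ofReal (Real.exp (-(r * (1 - u)))) := by
  rw [lintegral_poissonMeasure, ← (hasSum_pow_mul_poisson r u).tsum_eq,
    ENNReal.ofReal_tsum_of_nonneg (fun k => by positivity) (hasSum_pow_mul_poisson r u).summable]
  refine tsum_congr fun k => ?_
  rw [ENNReal.ofReal_mul (by positivity), ENNReal.ofReal_pow hu]

theorem lintegral_natCast_poissonMeasure (r : ℝ≥0) :
    ∫⁻ k : ℕ, (k : ℝ≥0∞) ∂poissonMeasure r = r := by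
  rw [lintegral_poissonMeasure, tsum_eq_zero_add' ENNReal.summable]
  have h := (NormedSpace.expSeries_div_hasSum_exp (r : ℝ)).mul_left (Real.exp (-r) * r)
  rw [← Real.exp_eq_exp_ℝ, mul_right_comm, ← Real.exp_add, neg_add_cancel, Real.exp_zero,
    one_mul] at h
  conv_rhs => rw [← ENNReal.ofReal_coe_nnreal, ← h.tsum_eq,
    ENNReal.ofReal_tsum_of_nonneg (fun k => by positivity) h.summable]
  simp only [Nat.cast_zero, zero_mul, zero_add]
  refine tsum_congr fun k => ?_
  rw [← ENNReal.ofReal_natCast, ← ENNReal.ofReal_mul (by positivity)]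
  congr 1
  rw [Nat.factorial_succ]
  push_cast
  field_simp
  ring

/-- From `e^(-r) ≥ 1 - r` one gets `1 - (1 + r) e^(-r) ≤ r²`. The quadratic order is what excludes
ties later. -/
theorem poissonMeasure_two_le (r : ℝ≥0) :
    poissonMeasure r {k | 2 ≤ k} ≤ ENNReal.ofReal ((r : ℝ) ^ 2) := by
  have e : {k : ℕ | 2 ≤ k} = ({0} ∪ {1})ᶜ := by ext k; simp; omega
  rw [← ENNReal.ofReal_toReal (measure_ne_top (poissonMeasure r) _)]
  refine ENNReal.ofReal_le_ofReal ?_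
  change (poissonMeasure r).real _ ≤ _
  rw [e, probReal_compl_eq_one_sub .of_discrete,
    measureReal_union (by simp) .of_discrete, poissonMeasure_real_singleton,
    poissonMeasure_real_singleton]
  have h1 := Real.add_one_le_exp (-(r : ℝ))
  have h2 : (0 : ℝ) ≤ r := r.2
  simp
  nlinarith

/-- Bounded coefficients give radius at least one, and the interval `(0, 1)` accumulates at the
centre `0`, so the identity principle for analytic functions applies. -/
theorem eq_of_hasSum_mul_pow {a b : ℕ → ℝ} (ha : ∀ n, ‖a n‖ ≤ 1) (hb : ∀ n, ‖b n‖ ≤ 1)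
    {F : ℝ → ℝ} (hFa : ∀ s ∈ Set.Ioo (0 : ℝ) 1, HasSum (fun n => s ^ n * a n) (F s))
    (hFb : ∀ s ∈ Set.Ioo (0 : ℝ) 1, HasSum (fun n => s ^ n * b n) (F s)) : a = b := by
  have key : ∀ c : ℕ → ℝ, (∀ n, ‖c n‖ ≤ 1) →
      (∀ s ∈ Set.Ioo (0 : ℝ) 1, HasSum (fun n => s ^ n * c n) (F s)) →
      HasFPowerSeriesAt (FormalMultilinearSeries.ofScalars ℝ c).sum
        (FormalMultilinearSeries.ofScalars ℝ c) 0 ∧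
      ∀ s ∈ Set.Ioo (0 : ℝ) 1, (FormalMultilinearSeries.ofScalars ℝ c).sum s = F s := by
    intro c hc hF
    have hr : 1 ≤ (FormalMultilinearSeries.ofScalars ℝ c).radius := by
      refine FormalMultilinearSeries.le_radius_of_bound _ 1 (r := 1) fun n => ?_
      simpa [FormalMultilinearSeries.ofScalars_norm] using hc n
    refine ⟨(FormalMultilinearSeries.hasFPowerSeriesOnBall _
      (lt_of_lt_of_le one_pos hr)).hasFPowerSeriesAt, fun s hs => ?_⟩
    rw [← (hF s hs).tsum_eq, ← FormalMultilinearSeries.ofScalarsSum.eq_1,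
      FormalMultilinearSeries.ofScalars_sum_eq]
    simp [mul_comm]
  obtain ⟨ha1, ha2⟩ := key a ha hFa
  obtain ⟨hb1, hb2⟩ := key b hb hFb
  have hf : ∃ᶠ s in 𝓝[≠] (0 : ℝ), (FormalMultilinearSeries.ofScalars ℝ a).sum s =
      (FormalMultilinearSeries.ofScalars ℝ b).sum s := by
    have h : ∀ᶠ s in 𝓝[>] (0 : ℝ), (FormalMultilinearSeries.ofScalars ℝ a).sum s =
        (FormalMultilinearSeries.ofScalars ℝ b).sum s := by
      filter_upwards [Ioo_mem_nhdsGT one_pos] with s hs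
      rw [ha2 s hs, hb2 s hs]
    exact h.frequently.filter_mono (nhdsWithin_mono _ fun s hs => ne_of_gt hs)
  have he := (ha1.analyticAt.frequently_eq_iff_eventually_eq hb1.analyticAt).1 hf
  exact FormalMultilinearSeries.ofScalars_series_injective ℝ ℝ
    (ha1.eq_formalMultilinearSeries_of_eventually hb1 he)

/-- The derivative of the finite sum telescopes: minus the sum is an antiderivative of the
normalised integrand, and it vanishes at infinity. -/
theorem upperGamma_div_gamma {n : ℕ} (hn : 1 ≤ n) {b : ℝ} (hb : 0 ≤ b) :
    upperGamma n b / Real.Gamma n =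
      ∑ k ∈ Finset.range n, Real.exp (-b) * b ^ k / k.factorial := by
  obtain ⟨n, rfl⟩ : ∃ m, n = m + 1 := ⟨n - 1, by omega⟩
  have hd : ∀ t : ℝ, HasDerivAt
      (fun t => -∑ k ∈ Finset.range (n + 1), Real.exp (-t) * t ^ k / k.factorial)
      (Real.exp (-t) * t ^ n / n.factorial) t := by
    intro t
    clear hn
    induction n with
    | zero =>
      simpa using ((hasDerivAt_id t).fun_neg.exp).fun_neg
    | succ n ih =>
      simp_rw [Finset.sum_range_succ _ (n + 1), neg_add]
      have h1 := ((((hasDerivAt_id t).neg).exp.mul (hasDerivAt_pow (n + 1) t)).div_const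
        ((n + 1).factorial : ℝ)).neg
      convert! ih.add h1 using 1
      simp [Nat.factorial_succ]
      field_simp
      ring
  have ht : Tendsto
      (fun t : ℝ => -∑ k ∈ Finset.range (n + 1), Real.exp (-t) * t ^ k / k.factorial)
      atTop (𝓝 0) := by
    rw [← neg_zero]
    refine Tendsto.neg ?_
    rw [← Finset.sum_const_zero (s := Finset.range (n + 1))]
    refine tendsto_finsetSum _ fun k _ => ?_
    have := (Real.tendsto_pow_mul_exp_neg_atTop_nhds_zero k).div_const (k.factorial : ℝ)
    simpa [mul_comm] using this
  have hi := integral_Ioi_of_hasDerivAt_of_nonneg' (a := b) (fun t _ => hd t)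
    (fun t ht => by have : 0 < t := hb.trans_lt ht; positivity) ht
  rw [upperGamma, Nat.cast_add_one, Real.Gamma_nat_eq_factorial, ← integral_div]
  simp only [zero_sub, neg_neg] at hi
  rw [← hi]
  refine setIntegral_congr_fun measurableSet_Ioi fun t _ => ?_
  simp [mul_comm]

/-! ### Measurability of random counts -/

theorem natCast_le_encard_iff {ι : Type*} {n : ℕ} {S : Set ι} :
    (n : ℕ∞) ≤ S.encard ↔ ∃ t : Finset ι, t.card = n ∧ (t : Set ι) ⊆ S := by
  constructor
  · intro h
    obtain ⟨t, hts, ht⟩ := Set.exists_subset_encard_eq h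
    have hf : t.Finite := Set.finite_of_encard_eq_coe ht
    refine ⟨hf.toFinset, ?_, by simpa using hts⟩
    rw [hf.encard_eq_coe_toFinset_card] at ht
    exact_mod_cast ht
  · rintro ⟨t, rfl, hts⟩
    rw [← Set.encard_coe_eq_coe_finsetCard]
    exact Set.encard_le_encard hts

theorem measurableSet_natCast_le_encard {Ω : Type*} [MeasurableSpace Ω] {E : ℕ → Set Ω}
    (hE : ∀ i, MeasurableSet (E i)) (n : ℕ) :
    MeasurableSet {ω | (n : ℕ∞) ≤ {i | ω ∈ E i}.encard} := by
  have e : {ω | (n : ℕ∞) ≤ {i | ω ∈ E i}.encard} =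
      ⋃ (t : Finset ℕ) (_ : t.card = n), ⋂ i ∈ t, E i := by
    ext ω
    simp only [Set.mem_ofPred_eq, natCast_le_encard_iff, Set.mem_iUnion, Set.mem_iInter]
    simp [Set.subset_def]
  rw [e]
  exact .iUnion fun t => .iUnion fun _ => Finset.measurableSet_biInter t fun i _ => hE i

theorem measurable_encard {Ω : Type*} [MeasurableSpace Ω] {E : ℕ → Set Ω}
    (hE : ∀ i, MeasurableSet (E i)) : Measurable fun ω => {i | ω ∈ E i}.encard := by
  have hle := measurableSet_natCast_le_encard hE
  refine measurable_to_countable' fun a => ?_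
  induction a using ENat.recTopCoe with
  | top =>
    have e : (fun ω => {i | ω ∈ E i}.encard) ⁻¹' {⊤} =
        ⋂ n : ℕ, {ω | (n : ℕ∞) ≤ {i | ω ∈ E i}.encard} := by
      ext ω
      simp only [Set.mem_preimage, Set.mem_singleton_iff, Set.mem_iInter, Set.mem_ofPred_eq,
        ENat.eq_top_iff_forall_ge]
    rw [e]
    exact .iInter hle
  | coe n =>
    have e : (fun ω => {i | ω ∈ E i}.encard) ⁻¹' {(n : ℕ∞)} =
        {ω | (n : ℕ∞) ≤ {i | ω ∈ E i}.encard} \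
          {ω | ((n + 1 : ℕ) : ℕ∞) ≤ {i | ω ∈ E i}.encard} := by
      ext ω
      simp only [Set.mem_preimage, Set.mem_singleton_iff, Set.mem_sdiff, Set.mem_ofPred_eq, not_le]
      rw [Nat.cast_add_one, ENat.lt_add_one_iff (ENat.natCast_ne_top n), eq_comm, le_antisymm_iff]
    rw [e]
    exact (hle n).diff (hle (n + 1))

theorem measurable_pointCount {Ω E : Type*} [MeasurableSpace Ω] [MeasurableSpace E]
    {x : ℕ → Ω → E} (hx : ∀ i, Measurable (x i)) {B : Set E} (hB : MeasurableSet B) :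
    Measurable fun ω => pointCount (fun i => x i ω) B :=
  measurable_encard fun i => hx i hB

/-! ### Generating functional of the Poisson process -/

theorem antitone_prod_range {a : ℕ → ℝ≥0∞} (ha : ∀ i, a i ≤ 1) :
    Antitone fun m => ∏ i ∈ Finset.range m, a i :=
  antitone_nat_of_succ_le fun m => by
    rw [Finset.prod_range_succ]
    exact mul_le_of_le_one_right' (ha m)

/-- An infinite product of factors at most one is expressed as the infimum of its decreasing partial
products, so no convergence question arises. -/
theorem iInf_prod_range_eq {a : ℕ → ℝ≥0∞} (ha : ∀ i, a i ≤ 1) {J : Finset ℕ}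
    (hJ : ∀ i ∉ J, a i = 1) :
    ⨅ m, ∏ i ∈ Finset.range m, a i = ∏ i ∈ J, a i := by
  obtain ⟨M, hM⟩ : ∃ M, J ⊆ Finset.range M := J.exists_nat_subset_range
  have key : ∀ m, M ≤ m → ∏ i ∈ Finset.range m, a i = ∏ i ∈ J, a i := fun m hm =>
    (Finset.prod_subset (hM.trans (Finset.range_mono hm)) fun i _ hi => hJ i hi).symm
  refine le_antisymm ((iInf_le _ M).trans_eq (key M le_rfl)) (le_iInf fun m => ?_)
  rw [← key _ (le_max_right m M)]
  exact antitone_prod_range ha (le_max_left m M)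

/-- An infinite count contributes zero, so the generating function can be formed before the count is
known to be finite. -/
theorem iInf_prod_range_ite {u : ℝ≥0∞} (hu : u < 1) (J : Set ℕ) [DecidablePred (· ∈ J)] :
    ⨅ m, ∏ i ∈ Finset.range m, (if i ∈ J then u else 1) =
      if J.encard = ⊤ then 0 else u ^ J.encard.toNat := by
  have h1 : ∀ i, (if i ∈ J then u else 1) ≤ 1 := fun i => by split_ifs <;> simp [hu.le]
  split_ifs with h
  · refine le_antisymm (ge_of_tendsto' (ENNReal.tendsto_pow_atTop_nhds_zero_of_lt_one hu)
      fun k => ?_) zero_le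
    obtain ⟨t, rfl, htJ⟩ := natCast_le_encard_iff.1 (h ▸ le_top : (k : ℕ∞) ≤ J.encard)
    obtain ⟨M, hM⟩ := t.exists_nat_subset_range
    refine (iInf_le _ M).trans ?_
    calc ∏ i ∈ Finset.range M, (if i ∈ J then u else 1)
        ≤ ∏ i ∈ t, (if i ∈ J then u else 1) :=
          Finset.prod_le_prod_of_subset_of_le_one' hM fun i _ _ => h1 i
      _ = u ^ t.card := by
          rw [Finset.prod_congr rfl fun i hi => if_pos (htJ hi), Finset.prod_const]
  · have hf : J.Finite := Set.encard_ne_top_iff.1 h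
    rw [iInf_prod_range_eq h1 (J := hf.toFinset) (by simp +contextual),
      hf.encard_eq_coe_toFinset_card, ENat.toNat_natCast, ← Finset.prod_const]
    exact Finset.prod_congr rfl fun i hi => by simp_all

/-- The level sets of `v` are disjoint, so their counts are independent Poisson variables, and the
product is a finite product of `(1 - c) ^ N_c` over the values `c`. -/
theorem lintegral_iInf_prod_simpleFunc {Ω : Type*} [MeasurableSpace Ω] {P : Measure Ω}
    [IsProbabilityMeasure P] {lam : ℝ} (hlam : 0 ≤ lam) {x : ℕ → Ω → Plane}
    (hx : IsHomogeneousPPP P lam x) (v : SimpleFunc Plane ℝ≥0∞) (hv : ∀ y, v y ≤ 1)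
    (hfin : ∫⁻ y, v y ≠ ⊤) :
    ∫⁻ ω, ⨅ m, ∏ i ∈ Finset.range m, (1 - v (x i ω)) ∂P =
      ENNReal.ofReal (Real.exp (-(lam * (∫⁻ y, v y).toReal))) := by
  -- The value `0` is left out: its level set may have infinite area, but its factors are all one.
  set S := v.range.filter (· ≠ 0) with hS
  have hS1 : ∀ c ∈ S, c ≤ 1 ∧ c ≠ 0 := by
    intro c hc
    obtain ⟨hc, hc0⟩ := Finset.mem_filter.1 hc
    obtain ⟨y, rfl⟩ := SimpleFunc.mem_range.1 hc
    exact ⟨hv y, hc0⟩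
  have hB : ∀ c, MeasurableSet (v ⁻¹' {c}) := fun c => v.measurableSet_fiber c
  have hvol : ∀ c ∈ S, volume (v ⁻¹' {c}) ≠ ⊤ := by
    intro c hc
    have h1 : c * volume (v ⁻¹' {c}) ≤ ∫⁻ y, v y := by
      refine le_trans ?_ (mul_meas_ge_le_lintegral v.measurable c)
      gcongr
      exact fun y hy => (Set.mem_singleton_iff.1 hy).ge
    intro h
    rw [h, ENNReal.mul_top (hS1 c hc).2, top_le_iff] at h1
    exact hfin h1
  let N : ℝ≥0∞ → Ω → ℕ∞ := fun c ω => pointCount (fun i => x i ω) (v ⁻¹' {c})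
  have hN : ∀ c, Measurable (N c) := fun c => measurable_pointCount hx.measurable (hB c)
  have hlaw := fun c hc => hx.count_law _ (hB c) (hvol c hc)
  let e := S.equivFin.symm
  have hind : iIndepFun (fun j ω => N (e j) ω) P := by
    refine hx.count_indep S.card (fun j => v ⁻¹' {(e j : ℝ≥0∞)}) (fun j => hB _)
      (fun j => hvol _ (e j).2) fun j l hjl => ?_
    exact Disjoint.preimage v (by simpa using fun h => hjl (e.injective (Subtype.ext h)))
  have hae : ∀ᵐ ω ∂P, ∀ c ∈ S, N c ω ≠ ⊤ :=
    (ae_ball_iff S.countable_toSet).2 fun c hc => ae_ne_top_of_poisson (hN c) (hlaw c hc)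
  have hprod : ∀ᵐ ω ∂P, ⨅ m, ∏ i ∈ Finset.range m, (1 - v (x i ω)) =
      ∏ j, (1 - (e j : ℝ≥0∞)) ^ (N (e j) ω).toNat := by
    filter_upwards [hae] with ω hω
    have hf : ∀ c ∈ S, {i | v (x i ω) = c}.Finite := fun c hc => Set.encard_ne_top_iff.1 (hω c hc)
    have hJ : {i | v (x i ω) ∈ S}.Finite := by
      have : {i | v (x i ω) ∈ S} = ⋃ c ∈ S, {i | v (x i ω) = c} := by ext; simp
      rw [this]
      exact Set.Finite.biUnion S.finite_toSet hf
    rw [iInf_prod_range_eq (fun i => tsub_le_self) (J := hJ.toFinset),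
      ← Finset.prod_fiberwise_of_maps_to (t := S) (g := fun i => v (x i ω)),
      e.prod_comp (fun c : S => (1 - (c : ℝ≥0∞)) ^ (N c ω).toNat),
      Finset.prod_coe_sort S (fun c => (1 - (c : ℝ≥0∞)) ^ (N c ω).toNat)]
    · refine Finset.prod_congr rfl fun c hc => ?_
      rw [Finset.prod_congr rfl fun i hi => by rw [(Finset.mem_filter.1 hi).2], Finset.prod_const]
      congr 1
      have : {i | v (x i ω) = c} = (hJ.toFinset.filter fun i => v (x i ω) = c : Finset ℕ) := by
        ext i
        simp only [Finset.coe_filter, Set.Finite.mem_toFinset, Set.mem_ofPred_eq]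
        exact ⟨fun h => ⟨h ▸ hc, h⟩, fun h => h.2⟩
      change _ = ({i | v (x i ω) = c}.encard).toNat
      rw [this, Set.encard_coe_eq_coe_finsetCard, ENat.toNat_natCast]
    · intro i hi
      simpa using hi
    · intro i hi
      have : v (x i ω) = 0 := by
        by_contra h
        exact hi (by simp [hS, h])
      simp [this]
  rw [lintegral_congr_ae hprod, lintegral_prod_eq_prod_lintegral_of_indepFun _
    (fun j ω => (1 - (e j : ℝ≥0∞)) ^ (N (e j) ω).toNat)
    (hind.comp (fun j k => (1 - (e j : ℝ≥0∞)) ^ k.toNat) fun _ => .of_discrete)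
    (fun j => (Measurable.of_discrete (f := fun k : ℕ∞ => (1 - (e j : ℝ≥0∞)) ^ k.toNat)).comp
      (hN (e j)))]
  have hterm : ∀ c ∈ S, ∫⁻ ω, (1 - c) ^ (N c ω).toNat ∂P =
      ENNReal.ofReal (Real.exp (-(lam * (c * volume (v ⁻¹' {c})).toReal))) := by
    intro c hc
    have hc1 : (1 - c) = ENNReal.ofReal (1 - c.toReal) := by
      rw [ENNReal.ofReal_sub _ ENNReal.toReal_nonneg, ENNReal.ofReal_one,
        ENNReal.ofReal_toReal (ne_top_of_le_ne_top ENNReal.one_ne_top (hS1 c hc).1)]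
    have hc2 : c.toReal ≤ 1 :=
      ENNReal.toReal_le_of_le_ofReal zero_le_one (by simpa using (hS1 c hc).1)
    rw [lintegral_comp_of_poisson (hN c) (hlaw c hc) (fun k => (1 - c) ^ k.toNat)]
    simp only [ENat.toNat_natCast]
    rw [hc1, lintegral_pow_poissonMeasure _ (by linarith), Real.coe_toNNReal _ (by positivity),
      ENNReal.toReal_mul]
    ring_nf
  rw [e.prod_comp (fun c : S => ∫⁻ ω, (1 - (c : ℝ≥0∞)) ^ (N c ω).toNat ∂P),
    Finset.prod_coe_sort S (fun c => ∫⁻ ω, (1 - c) ^ (N c ω).toNat ∂P),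
    Finset.prod_congr rfl hterm, ← ENNReal.ofReal_prod_of_nonneg (fun _ _ => (Real.exp_pos _).le),
    ← Real.exp_sum, Finset.sum_neg_distrib, ← Finset.mul_sum,
    ← ENNReal.toReal_sum (fun c hc => ENNReal.mul_ne_top
      (ne_top_of_le_ne_top ENNReal.one_ne_top (hS1 c hc).1) (hvol c hc)),
    SimpleFunc.lintegral_eq_lintegral, SimpleFunc.lintegral]
  congr 5
  refine Finset.sum_subset (Finset.filter_subset _ _) fun c hc hc' => ?_
  have : c = 0 := by simpa [hS, hc] using hc'
  simp [this]

/-- Simple functions increasing to `v` make the products decrease, and monotone convergence passes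
to the limit on both sides. -/
theorem lintegral_iInf_prod {Ω : Type*} [MeasurableSpace Ω] {P : Measure Ω}
    [IsProbabilityMeasure P] {lam : ℝ} (hlam : 0 ≤ lam) {x : ℕ → Ω → Plane}
    (hx : IsHomogeneousPPP P lam x) {v : Plane → ℝ≥0∞} (hvm : Measurable v) (hv : ∀ y, v y ≤ 1)
    (hfin : ∫⁻ y, v y ≠ ⊤) :
    ∫⁻ ω, ⨅ m, ∏ i ∈ Finset.range m, (1 - v (x i ω)) ∂P =
      ENNReal.ofReal (Real.exp (-(lam * (∫⁻ y, v y).toReal))) := by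
  let w := SimpleFunc.eapprox v
  have hw : ∀ n y, w n y ≤ v y := fun n y => by
    rw [← SimpleFunc.iSup_eapprox_apply hvm]
    exact le_iSup (fun n => (w n) y) n
  have hwfin : ∀ n, ∫⁻ y, w n y ≠ ⊤ := fun n => ne_top_of_le_ne_top hfin (lintegral_mono (hw n))
  let G : ℕ → Ω → ℝ≥0∞ := fun n ω => ⨅ m, ∏ i ∈ Finset.range m, (1 - w n (x i ω))
  have hanti : Antitone G := fun n k hnk ω => iInf_mono fun m => Finset.prod_le_prod' fun i _ =>
    tsub_le_tsub_left (SimpleFunc.monotone_eapprox v hnk _) _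
  have hpt : ∀ ω, ⨅ m, ∏ i ∈ Finset.range m, (1 - v (x i ω)) = ⨅ n, G n ω := by
    intro ω
    simp only [G]
    rw [iInf_comm]
    refine iInf_congr fun m => ?_
    have ht : Tendsto (fun n => ∏ i ∈ Finset.range m, (1 - w n (x i ω))) atTop
        (𝓝 (∏ i ∈ Finset.range m, (1 - v (x i ω)))) := by
      refine ENNReal.tendsto_finsetProd_of_ne_top _ (fun i _ => ?_) fun i _ => ?_
      · exact ENNReal.Tendsto.sub tendsto_const_nhds (SimpleFunc.tendsto_eapprox hvm _)
          (.inl ENNReal.one_ne_top)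
      · exact ne_top_of_le_ne_top ENNReal.one_ne_top tsub_le_self
    refine tendsto_nhds_unique ht (tendsto_atTop_iInf fun n k hnk => ?_)
    exact Finset.prod_le_prod' fun i _ =>
      tsub_le_tsub_left (SimpleFunc.monotone_eapprox v hnk _) _
  have hGm : ∀ n, Measurable (G n) := fun n => .iInf fun m => Finset.measurable_prod _ fun i _ =>
    ((w n).measurable.comp (hx.measurable i)).const_sub 1
  have hG : ∀ n, ∫⁻ ω, G n ω ∂P =
      ENNReal.ofReal (Real.exp (-(lam * (∫⁻ y, w n y).toReal))) := fun n =>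
    lintegral_iInf_prod_simpleFunc hlam hx (w n) (fun y => (hw n y).trans (hv y)) (hwfin n)
  rw [lintegral_congr hpt, lintegral_iInf hGm hanti (by rw [hG]; exact ENNReal.ofReal_ne_top)]
  have ht : Tendsto (fun n => ∫⁻ y, w n y) atTop (𝓝 (∫⁻ y, v y)) :=
    lintegral_tendsto_of_tendsto_of_monotone (fun n => (w n).measurable.aemeasurable)
      (ae_of_all _ fun y n k hnk => SimpleFunc.monotone_eapprox v hnk y)
      (ae_of_all _ fun y => SimpleFunc.tendsto_eapprox hvm y)
  have ht' := ENNReal.tendsto_ofReal ((Real.continuous_exp.tendsto _).comp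
    (((ENNReal.tendsto_toReal hfin).comp ht).const_mul lam).neg)
  refine tendsto_nhds_unique (tendsto_atTop_iInf fun n k hnk => lintegral_mono (hanti hnk)) ?_
  simp_rw [hG]
  exact ht'

/-! ### Marked Poisson process -/

/-- The data of the marked process: a homogeneous Poisson process with i.i.d. real marks that are
independent of the points. -/
structure IsMarkedPPP {Ω : Type*} [MeasurableSpace Ω] (P : Measure Ω) (lam : ℝ)
    (x : ℕ → Ω → Plane) (h : ℕ → Ω → ℝ) : Prop where
  ppp : IsHomogeneousPPP P lam x
  measurable : ∀ i, Measurable (h i)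
  indep : iIndepFun h P
  ident : ∀ i, IdentDistrib (h i) (h 0) P P
  indepFun : IndepFun (fun ω i => x i ω) (fun ω i => h i ω) P

theorem measurable_prod_range {E F : Type*} [MeasurableSpace E] [MeasurableSpace F]
    {f : E × F → ℝ≥0∞} (hf : Measurable f) (m : ℕ) :
    Measurable fun p : (ℕ → E) × (ℕ → F) => ∏ i ∈ Finset.range m, f (p.1 i, p.2 i) :=
  Finset.measurable_prod _ fun i _ => hf.comp (by fun_prop)

namespace IsMarkedPPP

variable {Ω : Type*} [MeasurableSpace Ω] {P : Measure Ω} {lam : ℝ}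
  {x : ℕ → Ω → Plane} {h : ℕ → Ω → ℝ}

theorem measurable_count (H : IsMarkedPPP P lam x h) {A : Set (Plane × ℝ)} (hA : MeasurableSet A) :
    Measurable fun ω => {i | (x i ω, h i ω) ∈ A}.encard :=
  measurable_encard fun i => ((H.ppp.measurable i).prodMk (H.measurable i)) hA

variable [IsProbabilityMeasure P]

/-- Fubini freezes the points; the independent marks then factorise the inner integral. -/
theorem lintegral_prod_range (H : IsMarkedPPP P lam x h) {f : Plane × ℝ → ℝ≥0∞}
    (hf : Measurable f) (m : ℕ) :
    ∫⁻ ω, ∏ i ∈ Finset.range m, f (x i ω, h i ω) ∂P =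
      ∫⁻ ω, ∏ i ∈ Finset.range m, (∫⁻ t, f (x i ω, t) ∂P.map (h 0)) ∂P := by
  have hxm : Measurable fun ω i => x i ω := measurable_pi_lambda _ H.ppp.measurable
  have hhm : Measurable fun ω i => h i ω := measurable_pi_lambda _ H.measurable
  have := Measure.isProbabilityMeasure_map (μ := P) hxm.aemeasurable
  have := Measure.isProbabilityMeasure_map (μ := P) hhm.aemeasurable
  have hF := measurable_prod_range hf m
  calc ∫⁻ ω, ∏ i ∈ Finset.range m, f (x i ω, h i ω) ∂P
      = ∫⁻ p, ∏ i ∈ Finset.range m, f (p.1 i, p.2 i)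
          ∂P.map (fun ω => (fun i => x i ω, fun i => h i ω)) := by
        rw [lintegral_map hF (hxm.prodMk hhm)]
    _ = ∫⁻ ω, ∫⁻ ω', ∏ i ∈ Finset.range m, f (x i ω, h i ω') ∂P ∂P := by
        rw [(indepFun_iff_map_prod_eq_prod_map_map hxm.aemeasurable hhm.aemeasurable).1 H.indepFun,
          lintegral_prod _ hF.aemeasurable, lintegral_map hF.lintegral_prod_right' hxm]
        refine lintegral_congr fun ω => ?_
        exact lintegral_map (hF.comp measurable_prodMk_left) hhm
    _ = _ := by
        refine lintegral_congr fun ω => ?_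
        rw [lintegral_prod_eq_prod_lintegral_of_indepFun _ (fun i ω' => f (x i ω, h i ω'))
          (H.indep.comp (fun i t => f (x i ω, t)) fun i => hf.comp measurable_prodMk_left)
          (fun i => (hf.comp measurable_prodMk_left).comp (H.measurable i))]
        refine Finset.prod_congr rfl fun i _ => ?_
        rw [← (H.ident i).map_eq]
        exact (lintegral_map (hf.comp measurable_prodMk_left) (H.measurable i)).symm

theorem lintegral_iInf_prod_ite (H : IsMarkedPPP P lam x h) (hlam : 0 ≤ lam)
    {A : Set (Plane × ℝ)} [DecidablePred (· ∈ A)] (hA : MeasurableSet A)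
    (hfin : (volume.prod (P.map (h 0))) A ≠ ⊤) {s : ℝ} (hs0 : 0 ≤ s) (hs1 : s ≤ 1) :
    ∫⁻ ω, ⨅ m, ∏ i ∈ Finset.range m, (if (x i ω, h i ω) ∈ A then ENNReal.ofReal s else 1) ∂P =
      ENNReal.ofReal (Real.exp
        (-(lam * ((volume.prod (P.map (h 0))) A).toReal * (1 - s)))) := by
  have := Measure.isProbabilityMeasure_map (μ := P) (H.measurable 0).aemeasurable
  set ν := P.map (h 0)
  let f : Plane × ℝ → ℝ≥0∞ := fun p => if p ∈ A then ENNReal.ofReal s else 1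
  have hf : Measurable f := .ite hA measurable_const measurable_const
  have hu : ENNReal.ofReal s ≤ 1 := by simpa using hs1
  have hf1 : ∀ p, f p ≤ 1 := fun p => by simp only [f]; split_ifs <;> simp [hs1]
  -- Averaging `f (y, ·)` over the mark gives `1 - v y`, the form required by the generating
  -- functional.
  let v : Plane → ℝ≥0∞ := fun y => ENNReal.ofReal (1 - s) * ν (Prod.mk y ⁻¹' A)
  have hvm : Measurable v := (measurable_measure_prodMk_left hA).const_mul _
  have hs' : ENNReal.ofReal (1 - s) ≤ 1 := by simpa using hs0
  have hv : ∀ y, v y ≤ 1 := fun y => mul_le_one' hs' prob_le_one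
  have hvint : ∫⁻ y, v y = ENNReal.ofReal (1 - s) * (volume.prod ν) A := by
    rw [lintegral_const_mul _ (measurable_measure_prodMk_left hA), Measure.prod_apply hA]
  have hfv : ∀ y, ∫⁻ t, f (y, t) ∂ν = 1 - v y := by
    intro y
    have hm : MeasurableSet (Prod.mk y ⁻¹' A) := measurable_prodMk_left hA
    have e : ∀ t, f (y, t) = 1 - (Prod.mk y ⁻¹' A).indicator (fun _ => ENNReal.ofReal (1 - s)) t := by
      intro t
      by_cases ht : (y, t) ∈ A
      · rw [Set.indicator_of_mem (by exact ht), ENNReal.ofReal_sub _ hs0, ENNReal.ofReal_one,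
          ENNReal.sub_sub_cancel ENNReal.one_ne_top hu]
        simp [f, ht]
      · rw [Set.indicator_of_notMem (by exact ht)]
        simp [f, ht]
    rw [lintegral_congr e, lintegral_sub (measurable_const.indicator hm),
      lintegral_indicator_const hm, lintegral_one, measure_univ]
    · rw [lintegral_indicator_const hm]
      exact ne_top_of_le_ne_top ENNReal.one_ne_top (hv y)
    · refine ae_of_all _ fun t => ?_
      exact Set.indicator_le' (fun _ _ => hs') (fun _ _ => zero_le) t
  have hmf : ∀ m, Measurable fun ω => ∏ i ∈ Finset.range m, f (x i ω, h i ω) := fun m =>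
    Finset.measurable_prod _ fun i _ => hf.comp ((H.ppp.measurable i).prodMk (H.measurable i))
  have hmv : ∀ m, Measurable fun ω => ∏ i ∈ Finset.range m, (1 - v (x i ω)) := fun m =>
    Finset.measurable_prod _ fun i _ => (hvm.comp (H.ppp.measurable i)).const_sub 1
  have key : ∀ m, ∫⁻ ω, ∏ i ∈ Finset.range m, f (x i ω, h i ω) ∂P =
      ∫⁻ ω, ∏ i ∈ Finset.range m, (1 - v (x i ω)) ∂P := by
    intro m
    rw [H.lintegral_prod_range hf]
    exact lintegral_congr fun ω => Finset.prod_congr rfl fun i _ => hfv _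
  change ∫⁻ ω, ⨅ m, ∏ i ∈ Finset.range m, f (x i ω, h i ω) ∂P = _
  -- Marks can be averaged out only in finite products, so the infimum is taken outside the
  -- integral, the products are exchanged, and the infimum is put back.
  rw [lintegral_iInf hmf (fun _ _ hij ω => antitone_prod_range (fun i => hf1 _) hij) (by simp)]
  rw [iInf_congr key, ← lintegral_iInf hmv (fun _ _ hij ω => antitone_prod_range (fun i => tsub_le_self) hij)
    (by simp), lintegral_iInf_prod hlam H.ppp hvm hv
      (by rw [hvint]; exact ENNReal.mul_ne_top ENNReal.ofReal_ne_top hfin), hvint,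
    ENNReal.toReal_mul, ENNReal.toReal_ofReal (by linarith)]
  ring_nf

/-- **Marking theorem**: the number of marked points in a set of finite intensity is Poisson. -/
theorem count_law (H : IsMarkedPPP P lam x h) (hlam : 0 ≤ lam) {A : Set (Plane × ℝ)}
    (hA : MeasurableSet A) (hfin : (volume.prod (P.map (h 0))) A ≠ ⊤) (k : ℕ) :
    P {ω | {i | (x i ω, h i ω) ∈ A}.encard = k} =
      poissonMeasure (lam * ((volume.prod (P.map (h 0))) A).toReal).toNNReal {k} := by
  classical
  set M := lam * ((volume.prod (P.map (h 0))) A).toReal with hM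
  have hM0 : 0 ≤ M := by positivity
  let N : Ω → ℕ∞ := fun ω => {i | (x i ω, h i ω) ∈ A}.encard
  have hN : Measurable N := H.measurable_count hA
  let a : ℕ → ℝ := fun k => P.real {ω | N ω = k}
  let b : ℕ → ℝ := fun k => Real.exp (-M) * M ^ k / k.factorial
  have hb : ∀ k, b k = (poissonMeasure M.toNNReal).real {k} := fun k => by
    rw [poissonMeasure_real_singleton, Real.coe_toNNReal _ hM0]
  have hsum : ∀ s ∈ Set.Ioo (0 : ℝ) 1,
      HasSum (fun n => s ^ n * a n) (Real.exp (-(M * (1 - s)))) := by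
    intro s hs
    have h1 := H.lintegral_iInf_prod_ite hlam hA hfin hs.1.le hs.2.le
    have h2 : ∀ ω, ⨅ m, ∏ i ∈ Finset.range m,
        (if (x i ω, h i ω) ∈ A then ENNReal.ofReal s else 1) =
        (fun k : ℕ∞ => if k = ⊤ then 0 else ENNReal.ofReal s ^ k.toNat) (N ω) := fun ω =>
      iInf_prod_range_ite (by simpa using hs.2) {i | (x i ω, h i ω) ∈ A}
    rw [lintegral_congr h2, ← lintegral_map (f := fun k : ℕ∞ => if k = ⊤ then 0 else
      ENNReal.ofReal s ^ k.toNat) .of_discrete hN, lintegral_countable'] at h1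
    have h3 : ∑' k : ℕ, ENNReal.ofReal (s ^ k * a k) = ENNReal.ofReal (Real.exp (-(M * (1 - s)))) := by
      -- The term at `⊤` is zero, so the sum over `ℕ∞` reduces to one over `ℕ`.
      rw [← h1, ← (Nat.cast_injective (R := ℕ∞)).tsum_eq]
      · refine tsum_congr fun k => ?_
        rw [Measure.map_apply hN (measurableSet_singleton _), ENNReal.ofReal_mul (by positivity [hs.1]),
          ENNReal.ofReal_pow hs.1.le, ofReal_measureReal]
        simp
        rfl
      · intro k hk
        induction k using ENat.recTopCoe with
        | top => simp at hk
        | coe k => simp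
    have h4 := ENNReal.hasSum_toReal (h3.trans_ne ENNReal.ofReal_ne_top)
    rw [← ENNReal.tsum_toReal_eq (fun _ => ENNReal.ofReal_ne_top), h3, ENNReal.toReal_ofReal (Real.exp_pos _).le] at h4
    refine h4.congr_fun fun n => ?_
    rw [ENNReal.toReal_ofReal]
    exact mul_nonneg (pow_nonneg hs.1.le _) measureReal_nonneg
  have hab : a = b := eq_of_hasSum_mul_pow
    (fun n => by simp only [a, Real.norm_of_nonneg measureReal_nonneg, measureReal_le_one])
    (fun n => by simp only [hb, Real.norm_of_nonneg measureReal_nonneg, measureReal_le_one])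
    hsum (fun s _ => hasSum_pow_mul_poisson M s)
  have := congr_fun hab k
  rw [hb] at this
  exact (measureReal_eq_measureReal_iff).1 this

end IsMarkedPPP

/-! ### Area of a planar sector -/

theorem planeAngle_eq (v : Plane) : planeAngle v =
    if Complex.arg ⟨v 0, v 1⟩ < 0 then Complex.arg ⟨v 0, v 1⟩ + 2 * Real.pi
    else Complex.arg ⟨v 0, v 1⟩ := by
  have h1 := Complex.neg_pi_lt_arg ⟨v 0, v 1⟩
  have h2 := Complex.arg_le_pi ⟨v 0, v 1⟩
  have h3 := Real.pi_pos
  unfold planeAngle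
  split_ifs with h
  · rw [← toIcoMod_add_right, toIcoMod_eq_self]
    constructor <;> linarith
  · rw [toIcoMod_eq_self]
    constructor <;> linarith

theorem measurable_planeAngle : Measurable planeAngle := by
  have h : Measurable fun v : Plane => Complex.arg ⟨v 0, v 1⟩ := by
    refine Complex.measurable_arg.comp ?_
    convert! Complex.measurableEquivPi.symm.measurable.comp
      (PiLp.volume_preserving_ofLp (Fin 2)).measurable using 1
    ext v
    apply Complex.ext <;> simp
  rw [funext planeAngle_eq]
  exact .ite (measurableSet_lt h measurable_const) (h.add_const _) h

/-- Polar coordinates use angles in `(-π, π)`. For `φ ≥ π` the admissible angles split into pieces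
of lengths `π` and `φ - π`. -/
theorem volume_setOf_angle_le {φ : ℝ} (hφ : 0 < φ) (hφ' : φ ≤ 2 * Real.pi) :
    volume {θ : ℝ | θ ∈ Set.Ioo (-Real.pi) Real.pi ∧
      (if θ < 0 then θ + 2 * Real.pi else θ) ≤ φ} = ENNReal.ofReal φ := by
  have hπ := Real.pi_pos
  rcases lt_or_ge φ Real.pi with h | h
  · have e : {θ : ℝ | θ ∈ Set.Ioo (-Real.pi) Real.pi ∧
        (if θ < 0 then θ + 2 * Real.pi else θ) ≤ φ} = Set.Icc 0 φ := by
      ext θ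
      simp only [Set.mem_ofPred_eq, Set.mem_Ioo, Set.mem_Icc]
      split_ifs with h0
      · exact ⟨fun h => by linarith, fun h => by linarith⟩
      · exact ⟨fun h => ⟨by linarith, h.2⟩, fun h => ⟨⟨by linarith, by linarith⟩, h.2⟩⟩
    rw [e, Real.volume_Icc, sub_zero]
  · have hle : {θ : ℝ | θ ∈ Set.Ioo (-Real.pi) Real.pi ∧
        (if θ < 0 then θ + 2 * Real.pi else θ) ≤ φ} ⊆
        Set.Ico 0 Real.pi ∪ Set.Ioc (-Real.pi) (φ - 2 * Real.pi) := by
      rintro θ ⟨h1, h2⟩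
      split_ifs at h2 with h0
      · exact .inr ⟨h1.1, by linarith⟩
      · exact .inl ⟨by linarith, h1.2⟩
    -- The right end is open here because for `φ = 2π` it equals `0`, which is not negative and
    -- already lies in the first piece.
    have hge : Set.Ico 0 Real.pi ∪ Set.Ioo (-Real.pi) (φ - 2 * Real.pi) ⊆
        {θ : ℝ | θ ∈ Set.Ioo (-Real.pi) Real.pi ∧
        (if θ < 0 then θ + 2 * Real.pi else θ) ≤ φ} := by
      rintro θ (h1 | h1)
      · refine ⟨⟨by linarith [h1.1], h1.2⟩, ?_⟩
        rw [if_neg (not_lt.2 h1.1)]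
        exact h1.2.le.trans h
      · have h0 : θ < 0 := by linarith [h1.2]
        refine ⟨⟨h1.1, by linarith⟩, ?_⟩
        rw [if_pos h0]
        linarith [h1.2]
    refine le_antisymm ((measure_mono hle).trans ((measure_union_le _ _).trans ?_))
      (le_trans ?_ (measure_mono hge))
    · rw [Real.volume_Ico, Real.volume_Ioc, ← ENNReal.ofReal_add (by linarith) (by linarith)]
      exact ENNReal.ofReal_le_ofReal (by linarith)
    · rw [measure_union _ measurableSet_Ioo, Real.volume_Ico, Real.volume_Ioo,
        ← ENNReal.ofReal_add (by linarith) (by linarith)]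
      · exact ENNReal.ofReal_le_ofReal (by linarith)
      · rw [Set.disjoint_left]
        intro θ h1 h2
        linarith [h1.1, h2.2]

theorem lintegral_Ioc_ofReal {R : ℝ} (hR : 0 ≤ R) :
    ∫⁻ t in Set.Ioc 0 R, ENNReal.ofReal t = ENNReal.ofReal (R ^ 2 / 2) := by
  rw [← ofReal_integral_eq_lintegral_ofReal, ← intervalIntegral.integral_of_le hR, integral_id]
  · simp
  · exact (continuous_id.integrableOn_Icc (a := 0) (b := R)).mono_set Set.Ioc_subset_Icc_self
  · filter_upwards [ae_restrict_mem measurableSet_Ioc] with t ht using ht.1.le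

theorem measurableSet_complex_sector (φ R : ℝ) : MeasurableSet
    {z : ℂ | (if z.arg < 0 then z.arg + 2 * Real.pi else z.arg) ≤ φ ∧ ‖z‖ ≤ R} :=
  have h := Complex.measurable_arg
  (measurableSet_le (.ite (measurableSet_lt h measurable_const) (h.add_const _) h)
    measurable_const).inter (measurableSet_le measurable_norm measurable_const)

/-- In polar coordinates the sector is the rectangle `Set.Ioc 0 R ×ˢ Θ`, so the area is `∫ ρ dρ =
R²/2` times the length of `Θ`. -/
theorem volume_complex_sector {φ R : ℝ} (hφ : 0 < φ) (hφ' : φ ≤ 2 * Real.pi) (hR : 0 ≤ R) :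
    volume {z : ℂ | (if z.arg < 0 then z.arg + 2 * Real.pi else z.arg) ≤ φ ∧ ‖z‖ ≤ R} =
      ENNReal.ofReal (φ / 2 * R ^ 2) := by
  set D := {z : ℂ | (if z.arg < 0 then z.arg + 2 * Real.pi else z.arg) ≤ φ ∧ ‖z‖ ≤ R}
  set Θ := {θ : ℝ | θ ∈ Set.Ioo (-Real.pi) Real.pi ∧
      (if θ < 0 then θ + 2 * Real.pi else θ) ≤ φ} with hΘ
  have hD : MeasurableSet D := measurableSet_complex_sector φ R
  have hΘm : MeasurableSet Θ := measurableSet_Ioo.inter (measurableSet_le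
    (.ite (measurableSet_lt measurable_id measurable_const) (measurable_id.add_const _)
      measurable_id) measurable_const)
  have ht : MeasurableSet (polarCoord.target) := polarCoord.open_target.measurableSet
  have h1 : ∀ p ∈ polarCoord.target,
      ENNReal.ofReal p.1 • D.indicator (1 : ℂ → ℝ≥0∞) (Complex.polarCoord.symm p) =
        (Set.Ioc 0 R ×ˢ Θ).indicator (fun p => ENNReal.ofReal p.1) p := by
    rintro ⟨ρ, θ⟩ ⟨hρ, hθ⟩
    have hρ : 0 < ρ := hρ
    have harg : (Complex.polarCoord.symm (ρ, θ)).arg = θ := by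
      rw [Complex.polarCoord_symm_apply]
      push_cast
      exact Complex.arg_mul_cos_add_sin_mul_I hρ ⟨hθ.1, hθ.2.le⟩
    have hnorm : ‖Complex.polarCoord.symm (ρ, θ)‖ = ρ := by
      rw [Complex.norm_polarCoord_symm, abs_of_pos hρ]
    have hiff : Complex.polarCoord.symm (ρ, θ) ∈ D ↔ (ρ, θ) ∈ Set.Ioc 0 R ×ˢ Θ := by
      simp only [D, Θ, Set.mem_ofPred_eq, harg, hnorm, Set.mem_prod, Set.mem_Ioc]
      exact ⟨fun h => ⟨⟨hρ, h.2⟩, hθ, h.1⟩, fun h => ⟨h.2.2, h.1.2⟩⟩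
    by_cases h : (ρ, θ) ∈ Set.Ioc 0 R ×ˢ Θ
    · rw [Set.indicator_of_mem h, Set.indicator_of_mem (hiff.2 h)]
      simp
    · rw [Set.indicator_of_notMem h, Set.indicator_of_notMem (mt hiff.1 h)]
      simp
  have hsub : Set.Ioc 0 R ×ˢ Θ ⊆ polarCoord.target := by
    rintro ⟨ρ, θ⟩ ⟨hρ, hθ⟩
    exact ⟨hρ.1, hθ.1⟩
  rw [← lintegral_indicator_one hD, ← Complex.lintegral_comp_polarCoord_symm,
    setLIntegral_congr_fun ht h1, lintegral_indicator (measurableSet_Ioc.prod hΘm),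
    Measure.restrict_restrict (measurableSet_Ioc.prod hΘm), Set.inter_eq_left.2 hsub,
    Measure.volume_eq_prod, ← Measure.prod_restrict,
    lintegral_prod _ (by fun_prop)]
  simp only [lintegral_const, Measure.restrict_apply MeasurableSet.univ, Set.univ_inter]
  rw [lintegral_mul_const _ (by fun_prop), lintegral_Ioc_ofReal hR, hΘ,
    volume_setOf_angle_le hφ hφ', ← ENNReal.ofReal_mul (by positivity)]
  congr 1
  ring

theorem volume_sector {φ R : ℝ} (hφ : 0 < φ) (hφ' : φ ≤ 2 * Real.pi) (hR : 0 ≤ R) :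
    volume {v : Plane | planeAngle v ≤ φ ∧ ‖v‖ ≤ R} = ENNReal.ofReal (φ / 2 * R ^ 2) := by
  rw [← volume_complex_sector hφ hφ' hR]
  have hmp : MeasurePreserving
      (fun v : Plane => Complex.measurableEquivPi.symm (WithLp.ofLp v)) :=
    Complex.volume_preserving_equiv_pi.symm.comp (PiLp.volume_preserving_ofLp (Fin 2))
  rw [← hmp.measure_preimage (measurableSet_complex_sector φ R).nullMeasurableSet]
  congr 1
  ext v
  have hz : Complex.measurableEquivPi.symm (WithLp.ofLp v) = ⟨v 0, v 1⟩ := by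
    apply Complex.ext <;> simp
  have hn : ‖(⟨v 0, v 1⟩ : ℂ)‖ = ‖v‖ := by
    rw [EuclideanSpace.norm_eq, Complex.norm_eq_sqrt_sq_add_sq]
    simp
  simp only [Set.mem_preimage, Set.mem_ofPred_eq, hz, hn, planeAngle_eq]

/-! ### Intensity of the transformed process -/

/-- Points and marks of the interferers whose transformed value lies in `B`. -/
def transformedSet (α φ : ℝ) (r : Plane) (B : Set ℝ) : Set (Plane × ℝ) :=
  {p | planeAngle (p.1 - r) ≤ φ ∧ ‖p.1 - r‖ ^ α / p.2 ∈ B}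

theorem measurableSet_transformedSet (α φ : ℝ) (r : Plane) {B : Set ℝ} (hB : MeasurableSet B) :
    MeasurableSet (transformedSet α φ r B) := by
  have h1 : Measurable fun p : Plane × ℝ => p.1 - r := by fun_prop
  have h2 : Measurable fun p : Plane × ℝ => ‖p.1 - r‖ ^ α / p.2 := by fun_prop
  exact (measurableSet_le (measurable_planeAngle.comp h1) measurable_const).inter (h2 hB)

theorem prod_transformedSet_Icc {α φ : ℝ} (hα : 2 < α) (hφ : 0 < φ) (hφ' : φ ≤ 2 * Real.pi)
    (r : Plane) (ν : Measure ℝ) [IsProbabilityMeasure ν] (hpos : ∀ᵐ t ∂ν, 0 < t)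
    (hint : Integrable (fun t => t ^ (2 / α)) ν) {z : ℝ} (hz : 0 ≤ z) :
    (volume.prod ν) (transformedSet α φ r (Set.Icc 0 z)) =
      ENNReal.ofReal (φ / 2 * (∫ t, t ^ (2 / α) ∂ν) * z ^ (2 / α)) := by
  have hα0 : 0 < α := by linarith
  -- Slicing is at a fixed mark, where the set is a translated sector.
  rw [Measure.prod_apply_symm (measurableSet_transformedSet α φ r measurableSet_Icc)]
  have h1 : ∀ᵐ t ∂ν, volume ((fun y => (y, t)) ⁻¹' transformedSet α φ r (Set.Icc 0 z)) =
      ENNReal.ofReal (φ / 2 * z ^ (2 / α) * t ^ (2 / α)) := by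
    filter_upwards [hpos] with t ht
    have e : (fun y => (y, t)) ⁻¹' transformedSet α φ r (Set.Icc 0 z) =
        (fun y => y - r) ⁻¹' {v | planeAngle v ≤ φ ∧ ‖v‖ ≤ (z * t) ^ (1 / α)} := by
      ext y
      simp only [transformedSet, Set.mem_preimage, Set.mem_ofPred_eq, Set.mem_Icc]
      refine and_congr_right fun _ => ?_
      rw [div_le_iff₀ ht, and_iff_right (by positivity), one_div,
        Real.le_rpow_inv_iff_of_pos (norm_nonneg _) (by positivity) hα0]
    simp_rw [e, sub_eq_add_neg]
    rw [measure_preimage_add_right, volume_sector hφ hφ' (by positivity),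
      ← Real.rpow_mul_natCast (by positivity), Real.mul_rpow hz ht.le]
    congr 1
    push_cast
    rw [show 1 / α * 2 = 2 / α by ring]
    ring
  rw [lintegral_congr_ae h1, ← ofReal_integral_eq_lintegral_ofReal (hint.const_mul _),
    integral_const_mul]
  · congr 1
    ring
  · filter_upwards [hpos] with t ht
    positivity

/-! ### Sorting in descending order -/

/-- A positive injective family on an infinite index set, with finitely many values above each
positive level, can be enumerated in descending order; the `n`-th value is the greatest level
reached by at least `n` members. -/
theorem exists_descending_enumeration {S : Set ℕ} {p : ℕ → ℝ} (hinf : S.Infinite)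
    (hinj : Set.InjOn p S) (hpos : ∀ i ∈ S, 0 < p i)
    (hfin : ∀ t, 0 < t → {i | i ∈ S ∧ t ≤ p i}.Finite) :
    ∃ s : ℕ → ℕ, Set.BijOn s Set.univ S ∧ StrictAnti (fun n => p (s n)) ∧
      ∀ n : ℕ, IsGreatest {t : ℝ | ((n + 1 : ℕ) : ℕ∞) ≤ {i | i ∈ S ∧ t ≤ p i}.encard}
        (p (s n)) := by
  let U : ℕ → Set ℕ := fun i => {j | j ∈ S ∧ p i < p j}
  have hU : ∀ i ∈ S, (U i).Finite := fun i hi =>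
    (hfin _ (hpos i hi)).subset fun j hj => ⟨hj.1, hj.2.le⟩
  -- The rank counts the members strictly above; the enumeration will be its inverse.
  let rank : ℕ → ℕ := fun i => (U i).ncard
  have hlt : ∀ i ∈ S, ∀ j ∈ S, p i < p j → rank j < rank i := fun i hi j hj hij =>
    Set.ncard_lt_ncard ⟨fun k hk => ⟨hk.1, hij.trans hk.2⟩,
      fun hs => lt_irrefl _ (hs (⟨hj, hij⟩ : j ∈ U i)).2⟩ (hU i hi)
  have hrinj : Set.InjOn rank S := by
    intro i hi j hj hij
    by_contra hne
    rcases lt_or_gt_of_ne (fun h => hne (hinj hi hj h)) with h | h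
    · exact (hlt i hi j hj h).ne' hij
    · exact (hlt j hj i hi h).ne hij
  have henc : ∀ i ∈ S, {j | j ∈ S ∧ p i ≤ p j}.encard = (rank i + 1 : ℕ) := by
    intro i hi
    have e : {j | j ∈ S ∧ p i ≤ p j} = insert i (U i) := by
      ext j
      simp only [Set.mem_ofPred_eq, Set.mem_insert_iff, U]
      constructor
      · rintro ⟨hj, h⟩
        rcases h.eq_or_lt with h | h
        · exact .inl (hinj hj hi h.symm)
        · exact .inr ⟨hj, h⟩
      · rintro (rfl | h)
        · exact ⟨hi, le_rfl⟩
        · exact ⟨h.1, h.2.le⟩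
    rw [e, Set.encard_insert_of_notMem (fun h => lt_irrefl _ h.2), ← (hU i hi).cast_ncard_eq]
    rfl
  have hsurj : ∀ n : ℕ, ∃ i ∈ S, rank i = n := by
    intro n
    obtain ⟨t, htc, htS⟩ := natCast_le_encard_iff.1
      (hinf.encard_eq ▸ le_top : ((n + 1 : ℕ) : ℕ∞) ≤ S.encard)
    have htne : t.Nonempty := Finset.card_pos.1 (by omega)
    -- The members at least as large as the lowest of `n + 1` chosen ones form a finite set of more
    -- than `n` elements. Ranks map it injectively into `{0, …, card - 1}`, hence onto, and `n` is
    -- attained.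
    obtain ⟨a, ha, hmin⟩ := t.exists_min_image p htne
    have hF := hfin (p a) (hpos a (htS ha))
    have hcard : n < hF.toFinset.card := by
      rw [← Nat.succ_le_iff, Nat.succ_eq_add_one, ← htc]
      exact Finset.card_le_card fun i hi => by simpa using ⟨htS hi, hmin i hi⟩
    have hmaps : ∀ i ∈ hF.toFinset, rank i ∈ Finset.range hF.toFinset.card := by
      intro i hi
      obtain ⟨hiS, hi⟩ : i ∈ S ∧ p a ≤ p i := by simpa using hi
      rw [Finset.mem_range, ← Set.ncard_eq_toFinset_card _ hF]
      exact Set.ncard_lt_ncard ⟨fun k hk => ⟨hk.1, hi.trans hk.2.le⟩,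
        fun hs => lt_irrefl _ (hs (⟨hiS, hi⟩ : i ∈ {i | i ∈ S ∧ p a ≤ p i})).2⟩ hF
    obtain ⟨i, hi, hin⟩ := Finset.surjOn_of_injOn_of_card_le rank hmaps
      (hrinj.mono fun i hi => by
        have : i ∈ S ∧ p a ≤ p i := by simpa using hi
        exact this.1) (by simp) (by simpa using hcard : n ∈ (Finset.range hF.toFinset.card : Set ℕ))
    have : i ∈ S ∧ p a ≤ p i := by simpa using hi
    exact ⟨i, this.1, hin⟩
  choose s hsS hs using hsurj
  refine ⟨s, ⟨fun n _ => hsS n, fun n _ m _ hnm => ?_, fun i hi => ?_⟩, fun n m hnm => ?_,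
    fun n => ⟨?_, fun t ht => ?_⟩⟩
  · rw [← hs n, ← hs m, hnm]
  · exact ⟨rank i, trivial, hrinj (hsS _) hi (hs _)⟩
  · by_contra! h
    rcases h.eq_or_lt with h | h
    · have := hinj (hsS n) (hsS m) h
      rw [← hs n, ← hs m, this] at hnm
      exact lt_irrefl _ hnm
    · have := hlt _ (hsS n) _ (hsS m) h
      rw [hs, hs] at this
      omega
  · change _ ≤ Set.encard _
    rw [henc _ (hsS n), hs]
  -- A level above `p (s n)` is reached only by members strictly above it, and there are just `n` of
  -- these.
  · by_contra! h
    have h1 : {i | i ∈ S ∧ t ≤ p i}.encard ≤ (n : ℕ∞) := by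
      rw [← hs n, (hU _ (hsS n)).cast_ncard_eq]
      exact Set.encard_le_encard fun j hj => ⟨hj.1, h.trans_le hj.2⟩
    have h2 : ((n + 1 : ℕ) : ℕ∞) ≤ n := le_trans ht h1
    rw [Nat.cast_le] at h2
    omega

theorem power_eq_inv (α : ℝ) (r y : Plane) (h : ℝ) : power α r y h = (‖y - r‖ ^ α / h)⁻¹ := by
  rw [power, norm_sub_rev, Real.rpow_neg (norm_nonneg _), inv_div, div_eq_mul_inv]

/-! ### Regular configurations -/

/-- The configurations for which the received powers have a descending arrangement. -/
structure IsRegular (α φ : ℝ) (r : Plane) (x : ℕ → Plane) (h : ℕ → ℝ) : Prop where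
  infinite : (interferers r φ x).Infinite
  pos : ∀ i, 0 < ‖x i - r‖ ^ α / h i
  injOn : Set.InjOn (fun i => ‖x i - r‖ ^ α / h i) (interferers r φ x)
  finite : ∀ z, transformedCount α φ r x h z ≠ ⊤

namespace IsRegular

variable {α φ : ℝ} {r : Plane} {x : ℕ → Plane} {h : ℕ → ℝ}

theorem setOf_le_power (H : IsRegular α φ r x h) {t : ℝ} (ht : 0 < t) :
    {i | i ∈ interferers r φ x ∧ t ≤ power α r (x i) (h i)} =
      {i | i ∈ interferers r φ x ∧ ‖x i - r‖ ^ α / h i ∈ Set.Icc 0 t⁻¹} := by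
  ext i
  simp only [Set.mem_ofPred_eq, power_eq_inv, Set.mem_Icc, (H.pos i).le, true_and,
    le_inv_comm₀ ht (H.pos i)]

theorem exists_enumeration (H : IsRegular α φ r x h) :
    ∃ s : ℕ → ℕ, Set.BijOn s Set.univ (interferers r φ x) ∧
      StrictAnti (fun n => power α r (x (s n)) (h (s n))) ∧
      ∀ n : ℕ, IsGreatest {t : ℝ | ((n + 1 : ℕ) : ℕ∞) ≤
        {i | i ∈ interferers r φ x ∧ t ≤ power α r (x i) (h i)}.encard}
        (power α r (x (s n)) (h (s n))) := by
  refine exists_descending_enumeration (p := fun i => power α r (x i) (h i)) H.infinite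
    (fun i hi j hj hij => ?_) (fun i _ => ?_) fun t ht => ?_
  · simp only [power_eq_inv, inv_inj] at hij
    exact H.injOn hi hj hij
  · rw [power_eq_inv]
    exact inv_pos.2 (H.pos i)
  · rw [H.setOf_le_power ht]
    exact Set.encard_ne_top_iff.1 (H.finite t⁻¹)

theorem isDescendingArrangement (H : IsRegular α φ r x h) :
    IsDescendingArrangement α φ r x h (nthDominant α φ r x h) := by
  obtain ⟨s, hs, hanti, hgr⟩ := H.exists_enumeration
  have he : ∀ n, nthDominant α φ r x h (n + 1) = power α r (x (s n)) (h (s n)) :=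
    fun n => (hgr n).csSup_eq
  exact ⟨by simpa only [he] using hanti, s, hs, he⟩

theorem nthDominant_pos (H : IsRegular α φ r x h) {n : ℕ} (hn : 1 ≤ n) :
    0 < nthDominant α φ r x h n := by
  obtain ⟨s, hs, hanti, hgr⟩ := H.exists_enumeration
  obtain ⟨n, rfl⟩ : ∃ m, n = m + 1 := ⟨n - 1, by omega⟩
  rw [nthDominant, (hgr n).csSup_eq, power_eq_inv]
  exact inv_pos.2 (H.pos _)

/-- The supremum is attained, so `t ≤ I_n` means that at least `n` powers reach `t`; inversion turns
these into points of `[0, t⁻¹]`. -/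
theorem nthDominant_lt_iff (H : IsRegular α φ r x h) {n : ℕ} (hn : 1 ≤ n) {t : ℝ} (ht : 0 < t) :
    nthDominant α φ r x h n < t ↔ transformedCount α φ r x h t⁻¹ < n := by
  obtain ⟨s, hs, hanti, hgr⟩ := H.exists_enumeration
  obtain ⟨n, rfl⟩ : ∃ m, n = m + 1 := ⟨n - 1, by omega⟩
  rw [transformedCount, ← H.setOf_le_power ht, nthDominant, (hgr n).csSup_eq, ← not_le, ← not_le,
    not_iff_not]
  refine ⟨fun h => (hgr n).1.trans (Set.encard_le_encard fun i hi => ⟨hi.1, h.trans hi.2⟩),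
    fun h => (hgr n).2 h⟩

end IsRegular

/-! ### The interference model and the law of its counts -/

/-- The Poisson distribution function `P(N < n)` as a function of the mean. -/
noncomputable def poissonCdf (n : ℕ) (b : ℝ) : ℝ :=
  ∑ k ∈ Finset.range n, Real.exp (-b) * b ^ k / k.factorial

theorem poissonMeasure_lt (b : ℝ) (hb : 0 ≤ b) (n : ℕ) :
    poissonMeasure b.toNNReal {k | k < n} = ENNReal.ofReal (poissonCdf n b) := by
  have e : {k : ℕ | k < n} = (Finset.range n : Set ℕ) := by ext; simp
  rw [e, ← sum_measure_singleton, poissonCdf, ENNReal.ofReal_sum_of_nonneg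
    (fun k _ => by positivity)]
  simp only [poissonMeasure_singleton, Real.coe_toNNReal _ hb]

theorem poissonCdf_nonneg {n : ℕ} {b : ℝ} (hb : 0 ≤ b) : 0 ≤ poissonCdf n b :=
  Finset.sum_nonneg fun k _ => by positivity

theorem continuous_poissonCdf (n : ℕ) : Continuous (poissonCdf n) := by
  unfold poissonCdf
  fun_prop

theorem tendsto_poissonCdf_atTop (n : ℕ) : Tendsto (poissonCdf n) atTop (𝓝 0) := by
  unfold poissonCdf
  rw [← Finset.sum_const_zero (s := Finset.range n)]
  refine tendsto_finsetSum _ fun k _ => ?_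
  simpa [mul_comm] using
    (Real.tendsto_pow_mul_exp_neg_atTop_nhds_zero k).div_const (k.factorial : ℝ)

/-- The standing assumptions on nodes, channel gains and path loss. -/
structure IsInterferenceModel {Ω : Type*} [MeasurableSpace Ω] (P : Measure Ω) (lam α φ : ℝ)
    (x : ℕ → Ω → Plane) (h : ℕ → Ω → ℝ) : Prop extends IsMarkedPPP P lam x h where
  lam_pos : 0 < lam
  two_lt : 2 < α
  phi_pos : 0 < φ
  phi_le : φ ≤ 2 * Real.pi
  pos : ∀ i, ∀ᵐ ω ∂P, 0 < h i ω
  moment : Integrable (fun ω => h 0 ω ^ (2 / α)) P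

/-- The mean number of points in `[0, z]` of the transformed process. -/
noncomputable def meanCount {Ω : Type*} [MeasurableSpace Ω] (P : Measure Ω) (lam α φ : ℝ)
    (h : ℕ → Ω → ℝ) (z : ℝ) : ℝ :=
  φ * lam / 2 * (∫ ω, h 0 ω ^ (2 / α) ∂P) * z ^ (2 / α)

namespace IsInterferenceModel

variable {Ω : Type*} [MeasurableSpace Ω] {P : Measure Ω} {lam α φ : ℝ}
  {x : ℕ → Ω → Plane} {h : ℕ → Ω → ℝ}

theorem measurable_transformedCount (H : IsInterferenceModel P lam α φ x h) (r : Plane) (z : ℝ) :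
    Measurable fun ω => transformedCount α φ r (fun i => x i ω) (fun i => h i ω) z :=
  H.measurable_count (measurableSet_transformedSet α φ r measurableSet_Icc)

variable [IsProbabilityMeasure P]

theorem moment_pos (H : IsInterferenceModel P lam α φ x h) : 0 < ∫ ω, h 0 ω ^ (2 / α) ∂P := by
  have hp : ∀ᵐ ω ∂P, 0 < h 0 ω ^ (2 / α) := by
    filter_upwards [H.pos 0] with ω hω using Real.rpow_pos_of_pos hω _
  rw [integral_pos_iff_support_of_nonneg_ae (hp.mono fun ω hω => hω.le) H.moment]
  have : P (Function.support fun ω => h 0 ω ^ (2 / α)) = 1 := by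
    rw [← mem_ae_iff_prob_eq_one₀ ?_]
    · exact hp.mono fun ω hω => hω.ne'
    · exact (((H.measurable 0).pow_const _) (measurableSet_singleton (0 : ℝ)).compl).nullMeasurableSet
  rw [this]
  exact one_pos

theorem const_pos (H : IsInterferenceModel P lam α φ x h) :
    0 < φ * lam / 2 * (∫ ω, h 0 ω ^ (2 / α) ∂P) := by
  have h1 := H.moment_pos
  have h2 := H.lam_pos
  have h3 := H.phi_pos
  positivity

theorem meanCount_nonneg (H : IsInterferenceModel P lam α φ x h) {z : ℝ} (hz : 0 ≤ z) :
    0 ≤ meanCount P lam α φ h z :=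
  mul_nonneg H.const_pos.le (Real.rpow_nonneg hz _)

/-- The product measure has unit spatial intensity; `count_law` supplies the factor `lam` that is
divided out here. -/
theorem prod_Icc (H : IsInterferenceModel P lam α φ x h) (r : Plane) {z : ℝ} (hz : 0 ≤ z) :
    (volume.prod (P.map (h 0))) (transformedSet α φ r (Set.Icc 0 z)) =
      ENNReal.ofReal (meanCount P lam α φ h z / lam) := by
  have := Measure.isProbabilityMeasure_map (μ := P) (H.measurable 0).aemeasurable
  have hm : Measurable fun t : ℝ => t ^ (2 / α) := measurable_id.pow_const _
  rw [prod_transformedSet_Icc H.two_lt H.phi_pos H.phi_le r _ _ _ hz,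
    integral_map (H.measurable 0).aemeasurable hm.aestronglyMeasurable]
  · congr 1
    have := H.lam_pos
    rw [meanCount]
    field_simp
  · rw [ae_map_iff (H.measurable 0).aemeasurable measurableSet_Ioi]
    exact H.pos 0
  · rw [integrable_map_measure hm.aestronglyMeasurable (H.measurable 0).aemeasurable]
    exact H.moment

theorem transformedCount_law (H : IsInterferenceModel P lam α φ x h) (r : Plane) {z : ℝ}
    (hz : 0 ≤ z) (k : ℕ) :
    P {ω | transformedCount α φ r (fun i => x i ω) (fun i => h i ω) z = k} =
      poissonMeasure (meanCount P lam α φ h z).toNNReal {k} := by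
  have h1 := H.count_law H.lam_pos.le (measurableSet_transformedSet α φ r measurableSet_Icc)
    (by rw [H.prod_Icc r hz]; exact ENNReal.ofReal_ne_top) k
  rw [H.prod_Icc r hz,
    ENNReal.toReal_ofReal (div_nonneg (H.meanCount_nonneg hz) H.lam_pos.le),
    mul_div_cancel₀ _ H.lam_pos.ne'] at h1
  exact h1

theorem transformedIntensity_eq (H : IsInterferenceModel P lam α φ x h) (r : Plane) {z : ℝ}
    (hz : 0 ≤ z) :
    transformedIntensity P α φ r x h z = ENNReal.ofReal (meanCount P lam α φ h z) := by
  rw [transformedIntensity, lintegral_comp_of_poisson (H.measurable_transformedCount r z)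
    (H.transformedCount_law r hz) (fun k => (k : ℝ≥0∞))]
  simp only [ENat.toENNReal_coe]
  rw [lintegral_natCast_poissonMeasure]
  rfl

theorem prob_transformedCount_lt (H : IsInterferenceModel P lam α φ x h) (r : Plane) {z : ℝ}
    (hz : 0 ≤ z) (n : ℕ) :
    P {ω | transformedCount α φ r (fun i => x i ω) (fun i => h i ω) z < n} =
      ENNReal.ofReal (poissonCdf n (meanCount P lam α φ h z)) := by
  rw [← poissonMeasure_lt _ (H.meanCount_nonneg hz)]
  refine (measure_preimage_of_poisson (H.measurable_transformedCount r z)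
    (H.transformedCount_law r hz) (Set.Iio n)).trans ?_
  congr 1
  ext k
  simp

theorem prod_Ioc (H : IsInterferenceModel P lam α φ x h) (r : Plane) {a b : ℝ} (ha : 0 ≤ a)
    (hab : a ≤ b) :
    (volume.prod (P.map (h 0))) (transformedSet α φ r (Set.Ioc a b)) =
      ENNReal.ofReal ((meanCount P lam α φ h b - meanCount P lam α φ h a) / lam) := by
  have e : transformedSet α φ r (Set.Ioc a b) =
      transformedSet α φ r (Set.Icc 0 b) \ transformedSet α φ r (Set.Icc 0 a) := by
    ext p
    simp only [transformedSet, Set.mem_ofPred_eq, Set.mem_sdiff, Set.mem_Ioc, Set.mem_Icc]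
    constructor
    · rintro ⟨h1, h2, h3⟩
      exact ⟨⟨h1, by linarith, h3⟩, fun h => by linarith [h.2.2]⟩
    · rintro ⟨⟨h1, h2, h3⟩, h4⟩
      exact ⟨h1, not_le.1 fun h => h4 ⟨h1, h2, h⟩, h3⟩
  have hs : transformedSet α φ r (Set.Icc 0 a) ⊆ transformedSet α φ r (Set.Icc 0 b) :=
    fun p hp => ⟨hp.1, hp.2.1, hp.2.2.trans hab⟩
  rw [e, measure_sdiff hs
    (measurableSet_transformedSet α φ r measurableSet_Icc).nullMeasurableSet
    (by rw [H.prod_Icc r ha]; exact ENNReal.ofReal_ne_top), H.prod_Icc r ha,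
    H.prod_Icc r (ha.trans hab), ← ENNReal.ofReal_sub _
      (div_nonneg (H.meanCount_nonneg ha) H.lam_pos.le), sub_div]

theorem meanCount_mono (H : IsInterferenceModel P lam α φ x h) {a b : ℝ} (ha : 0 ≤ a)
    (hab : a ≤ b) : meanCount P lam α φ h a ≤ meanCount P lam α φ h b := by
  have := H.two_lt
  exact mul_le_mul_of_nonneg_left (Real.rpow_le_rpow ha hab (by positivity)) H.const_pos.le

theorem prob_two_le_count_Ioc (H : IsInterferenceModel P lam α φ x h) (r : Plane) {a b : ℝ}
    (ha : 0 ≤ a) (hab : a ≤ b) :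
    P {ω | 2 ≤ {i | (x i ω, h i ω) ∈ transformedSet α φ r (Set.Ioc a b)}.encard} ≤
      ENNReal.ofReal ((meanCount P lam α φ h b - meanCount P lam α φ h a) ^ 2) := by
  have hA := measurableSet_transformedSet α φ r (measurableSet_Ioc (a := a) (b := b))
  have h0 : 0 ≤ meanCount P lam α φ h b - meanCount P lam α φ h a :=
    sub_nonneg.2 (H.meanCount_mono ha hab)
  have h1 := measure_preimage_of_poisson (H.measurable_count hA) (H.count_law H.lam_pos.le hA
    (by rw [H.prod_Ioc r ha hab]; exact ENNReal.ofReal_ne_top)) (Set.Ici 2)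
  rw [H.prod_Ioc r ha hab, ENNReal.toReal_ofReal (div_nonneg h0 H.lam_pos.le),
    mul_div_cancel₀ _ H.lam_pos.ne'] at h1
  refine (h1.trans_le ?_)
  have h2 := poissonMeasure_two_le (meanCount P lam α φ h b - meanCount P lam α φ h a).toNNReal
  rw [Real.coe_toNNReal _ h0] at h2
  refine le_trans (measure_mono fun k hk => ?_) h2
  have : ((2 : ℕ) : ℕ∞) ≤ (k : ℕ∞) := hk
  exact_mod_cast this

/-- A single point has area zero, so its count is Poisson with mean zero. -/
theorem ae_ne (H : IsInterferenceModel P lam α φ x h) (r : Plane) : ∀ᵐ ω ∂P, ∀ i, x i ω ≠ r := by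
  have h1 := H.ppp.count_law {r} (measurableSet_singleton r) (by simp) 
  have h2 := measure_preimage_of_poisson
    (measurable_pointCount H.ppp.measurable (measurableSet_singleton r)) h1 {0}ᶜ
  have h3 : poissonMeasure (lam * (volume ({r} : Set Plane)).toReal).toNNReal
      {k : ℕ | (k : ℕ∞) ∈ ({0}ᶜ : Set ℕ∞)} = 0 := by
    have e : {k : ℕ | (k : ℕ∞) ∈ ({0}ᶜ : Set ℕ∞)} = {0}ᶜ := by ext; simp
    rw [e, prob_compl_eq_zero_iff .of_discrete, poissonMeasure_singleton]
    simp
  rw [h3] at h2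
  filter_upwards [measure_eq_zero_iff_ae_notMem.1 h2] with ω hω i hi
  simp only [Set.mem_preimage, Set.mem_compl_iff, Set.mem_singleton_iff, not_not, pointCount,
    Set.encard_eq_zero] at hω
  exact Set.eq_empty_iff_forall_notMem.1 hω i hi

theorem ae_pos (H : IsInterferenceModel P lam α φ x h) (r : Plane) :
    ∀ᵐ ω ∂P, ∀ i, 0 < ‖x i ω - r‖ ^ α / h i ω := by
  filter_upwards [H.ae_ne r, ae_all_iff.2 H.pos] with ω h1 h2 i
  exact div_pos (Real.rpow_pos_of_pos (norm_pos_iff.2 (sub_ne_zero.2 (h1 i))) _) (h2 i)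

theorem ae_finite (H : IsInterferenceModel P lam α φ x h) (r : Plane) :
    ∀ᵐ ω ∂P, ∀ z, transformedCount α φ r (fun i => x i ω) (fun i => h i ω) z ≠ ⊤ := by
  have h1 : ∀ᵐ ω ∂P, ∀ k : ℕ,
      transformedCount α φ r (fun i => x i ω) (fun i => h i ω) k ≠ ⊤ :=
    ae_all_iff.2 fun k => ae_ne_top_of_poisson (H.measurable_transformedCount r k)
      (H.transformedCount_law r (Nat.cast_nonneg k))
  filter_upwards [h1] with ω hω z
  obtain ⟨k, hk⟩ := exists_nat_ge z
  exact ne_top_of_le_ne_top (hω k) (Set.encard_le_encard fun i hi =>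
    ⟨hi.1, hi.2.1, hi.2.2.trans hk⟩)

theorem tendsto_meanCount (H : IsInterferenceModel P lam α φ x h) :
    Tendsto (meanCount P lam α φ h) atTop atTop := by
  have := H.two_lt
  exact (tendsto_rpow_atTop (by positivity)).const_mul_atTop H.const_pos

/-- Having fewer than `n` interferers forces `N_z < n` for every `z`, and that probability tends to
zero as the mean grows. -/
theorem ae_infinite (H : IsInterferenceModel P lam α φ x h) (r : Plane) :
    ∀ᵐ ω ∂P, (interferers r φ fun i => x i ω).Infinite := by
  have h1 : ∀ n : ℕ, ∀ᵐ ω ∂P, (n : ℕ∞) ≤ (interferers r φ fun i => x i ω).encard := by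
    intro n
    rw [ae_iff]
    have hle : ∀ᶠ z : ℝ in atTop, P {ω | ¬(n : ℕ∞) ≤ (interferers r φ fun i => x i ω).encard} ≤
        ENNReal.ofReal (poissonCdf n (meanCount P lam α φ h z)) := by
      filter_upwards [eventually_ge_atTop 0] with z hz
      rw [← H.prob_transformedCount_lt r hz]
      refine measure_mono fun ω hω => ?_
      exact lt_of_le_of_lt (Set.encard_le_encard fun i hi => hi.1) (not_le.1 hω)
    have ht := ENNReal.tendsto_ofReal ((tendsto_poissonCdf_atTop n).comp H.tendsto_meanCount)
    rw [ENNReal.ofReal_zero] at ht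
    exact le_antisymm (ge_of_tendsto ht hle) zero_le
  filter_upwards [ae_all_iff.2 h1] with ω hω
  rw [← Set.encard_eq_top_iff]
  exact ENat.eq_top_iff_forall_ge.2 hω

end IsInterferenceModel

/-! ### Absence of ties and the distribution function -/

namespace IsInterferenceModel

variable {Ω : Type*} [MeasurableSpace Ω] {P : Measure Ω} [IsProbabilityMeasure P]
  {lam α φ : ℝ} {x : ℕ → Ω → Plane} {h : ℕ → Ω → ℝ}

/-- Cut `[0, Z]` into `n` cells of equal mean count: a tie puts two points into one cell. -/
theorem prob_tie_le (H : IsInterferenceModel P lam α φ x h) (r : Plane) {Z : ℝ} (hZ : 0 < Z)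
    {n : ℕ} (hn : 0 < n) :
    P {ω | ∃ i ∈ interferers r φ (fun i => x i ω), ∃ j ∈ interferers r φ (fun i => x i ω),
        i ≠ j ∧ ‖x i ω - r‖ ^ α / h i ω = ‖x j ω - r‖ ^ α / h j ω ∧
        ‖x i ω - r‖ ^ α / h i ω ∈ Set.Ioc 0 Z} ≤
      ENNReal.ofReal (meanCount P lam α φ h Z ^ 2 / n) := by
  have hα : 0 < α := by linarith [H.two_lt]
  have hn' : (0 : ℝ) < n := by exact_mod_cast hn
  -- The exponent `α / 2` inverts the growth `z ^ (2 / α)` of the mean, so the cells have equal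
  -- mean.
  let c : ℕ → ℝ := fun j => Z * (j / n) ^ (α / 2)
  have hc0 : ∀ j, 0 ≤ c j := fun j => by positivity
  have hcm : ∀ j, c j ≤ c (j + 1) := fun j => by
    simp only [c]
    gcongr
    simp
  have hmean : ∀ j, meanCount P lam α φ h (c j) = meanCount P lam α φ h Z * (j / n) := by
    intro j
    have e : α / 2 * (2 / α) = 1 := by field_simp
    simp only [meanCount, c]
    rw [Real.mul_rpow hZ.le (by positivity), ← Real.rpow_mul (by positivity), e, Real.rpow_one]
    ring
  have hcell : ∀ T ∈ Set.Ioc 0 Z, ∃ j ∈ Finset.range n, T ∈ Set.Ioc (c j) (c (j + 1)) := by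
    rintro T ⟨hT0, hTZ⟩
    have hTZ0 : 0 < T / Z := by positivity
    -- `u` is the fraction of the mean carried by `[0, T]`. As cells are open on the left, `T` has
    -- cell index `⌈n * u⌉₊ - 1`.
    set u := (T / Z) ^ (2 / α) with hu
    have hu0 : 0 < u := by positivity
    have hu1 : u ≤ 1 := Real.rpow_le_one hTZ0.le ((div_le_one hZ).2 hTZ) (by positivity)
    have hTu : T = Z * u ^ (α / 2) := by
      have e : 2 / α * (α / 2) = 1 := by field_simp
      rw [hu, ← Real.rpow_mul hTZ0.le, e, Real.rpow_one]
      field_simp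
    have hpos : 0 < ⌈n * u⌉₊ := Nat.ceil_pos.2 (by positivity)
    obtain ⟨j, hj⟩ : ∃ j, ⌈n * u⌉₊ = j + 1 := ⟨⌈n * u⌉₊ - 1, by omega⟩
    have h1 : (n : ℝ) * u ≤ (j + 1 : ℕ) := hj ▸ Nat.le_ceil _
    have h2 : (j : ℝ) < n * u := Nat.lt_ceil.1 (by omega)
    refine ⟨j, ?_, ?_, ?_⟩
    · rw [Finset.mem_range]
      have : (j : ℝ) < n := h2.trans_le (mul_le_of_le_one_right hn'.le hu1)
      exact_mod_cast this
    · rw [hTu]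
      have : (j : ℝ) / n < u := by rwa [div_lt_iff₀' hn']
      exact mul_lt_mul_of_pos_left (Real.rpow_lt_rpow (by positivity) this (by positivity)) hZ
    · rw [hTu]
      have : u ≤ ((j + 1 : ℕ) : ℝ) / n := by rwa [le_div_iff₀' hn']
      exact mul_le_mul_of_nonneg_left (Real.rpow_le_rpow hu0.le this (by positivity)) hZ.le
  calc _ ≤ P (⋃ k ∈ Finset.range n,
        {ω | 2 ≤ {i | (x i ω, h i ω) ∈ transformedSet α φ r (Set.Ioc (c k) (c (k + 1)))}.encard}) := by
        refine measure_mono ?_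
        rintro ω ⟨i, hi, j, hj, hij, he, hT⟩
        obtain ⟨k, hk, hTk⟩ := hcell _ hT
        refine Set.mem_biUnion hk ?_
        rw [Set.mem_ofPred_eq, ← Set.encard_pair hij]
        refine Set.encard_le_encard ?_
        rintro l (rfl | rfl)
        · exact ⟨hi, hTk⟩
        · exact ⟨hj, he ▸ hTk⟩
    _ ≤ ∑ k ∈ Finset.range n, ENNReal.ofReal ((meanCount P lam α φ h Z / n) ^ 2) := by
        refine (measure_biUnion_finset_le _ _).trans (Finset.sum_le_sum fun k _ => ?_)
        refine (H.prob_two_le_count_Ioc r (hc0 k) (hcm k)).trans_eq ?_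
        rw [hmean, hmean]
        congr 2
        push_cast
        ring
    _ = _ := by
        rw [Finset.sum_const, Finset.card_range, nsmul_eq_mul, ← ENNReal.ofReal_natCast,
          ← ENNReal.ofReal_mul hn'.le]
        congr 1
        field_simp

theorem ae_injOn (H : IsInterferenceModel P lam α φ x h) (r : Plane) :
    ∀ᵐ ω ∂P, Set.InjOn (fun i => ‖x i ω - r‖ ^ α / h i ω)
      (interferers r φ fun i => x i ω) := by
  have h1 : ∀ k : ℕ, P {ω | ∃ i ∈ interferers r φ (fun i => x i ω),
      ∃ j ∈ interferers r φ (fun i => x i ω),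
        i ≠ j ∧ ‖x i ω - r‖ ^ α / h i ω = ‖x j ω - r‖ ^ α / h j ω ∧
        ‖x i ω - r‖ ^ α / h i ω ∈ Set.Ioc (0 : ℝ) (k + 1 : ℕ)} = 0 := by
    intro k
    have ht := ENNReal.tendsto_ofReal (tendsto_const_div_atTop_nhds_zero_nat
      (meanCount P lam α φ h (k + 1 : ℕ) ^ 2))
    rw [ENNReal.ofReal_zero] at ht
    refine le_antisymm (ge_of_tendsto ht ?_) zero_le
    filter_upwards [eventually_gt_atTop 0] with n hn
    exact H.prob_tie_le r (by positivity) hn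
  filter_upwards [ae_all_iff.2 fun k => measure_eq_zero_iff_ae_notMem.1 (h1 k), H.ae_pos r]
    with ω hω hpos i hi j hj hij
  by_contra hne
  obtain ⟨k, hk⟩ := exists_nat_ge (‖x i ω - r‖ ^ α / h i ω)
  exact hω k ⟨i, hi, j, hj, hne, hij, hpos i, hk.trans (by simp)⟩

theorem ae_isRegular (H : IsInterferenceModel P lam α φ x h) (r : Plane) :
    ∀ᵐ ω ∂P, IsRegular α φ r (fun i => x i ω) (fun i => h i ω) := by
  filter_upwards [H.ae_infinite r, H.ae_pos r, H.ae_injOn r, H.ae_finite r] with ω h1 h2 h3 h4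
  exact ⟨h1, h2, h3, h4⟩

/-- On regular configurations the events `I_n < t` are count events, or empty when `t ≤ 0`; off them
nothing is known, hence only almost everywhere measurability. -/
theorem aemeasurable_nthDominant (H : IsInterferenceModel P lam α φ x h) (r : Plane) {n : ℕ}
    (hn : 1 ≤ n) :
    AEMeasurable (fun ω => nthDominant α φ r (fun i => x i ω) (fun i => h i ω) n) P := by
  refine NullMeasurable.aemeasurable ?_
  refine measurable_of_Iio (α := ℝ) (δ := NullMeasurableSpace Ω P) fun t => ?_
  change NullMeasurableSet
    {ω | nthDominant α φ r (fun i => x i ω) (fun i => h i ω) n < t} P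
  rcases le_or_gt t 0 with ht | ht
  · refine (MeasurableSet.empty.nullMeasurableSet (μ := P)).congr ?_
    filter_upwards [H.ae_isRegular r] with ω hω
    exact propext ⟨fun h => h.elim, fun h => absurd (hω.nthDominant_pos hn) (not_lt.2 (h.le.trans ht))⟩
  · have hm : MeasurableSet
        {ω | transformedCount α φ r (fun i => x i ω) (fun i => h i ω) t⁻¹ < n} :=
      H.measurable_transformedCount r t⁻¹ (.of_discrete (s := Set.Iio (n : ℕ∞)))
    refine hm.nullMeasurableSet.congr ?_
    filter_upwards [H.ae_isRegular r] with ω hω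
    exact propext (hω.nthDominant_lt_iff hn ht).symm

theorem prob_nthDominant_lt (H : IsInterferenceModel P lam α φ x h) (r : Plane) {n : ℕ}
    (hn : 1 ≤ n) {t : ℝ} (ht : 0 < t) :
    P.real {ω | nthDominant α φ r (fun i => x i ω) (fun i => h i ω) n < t} =
      poissonCdf n (meanCount P lam α φ h t⁻¹) := by
  rw [measureReal_def, ← ENNReal.toReal_ofReal (poissonCdf_nonneg
    (H.meanCount_nonneg (inv_pos.2 ht).le)), ← H.prob_transformedCount_lt r (inv_pos.2 ht).le]
  congr 1
  refine measure_congr ?_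
  filter_upwards [H.ae_isRegular r] with ω hω
  exact propext (hω.nthDominant_lt_iff hn ht)

theorem cdf_nthDominant_eq (H : IsInterferenceModel P lam α φ x h) (r : Plane) {n : ℕ}
    (hn : 1 ≤ n) (z : ℝ) :
    cdf (P.map fun ω => nthDominant α φ r (fun i => x i ω) (fun i => h i ω) n) z =
      P.real {ω | nthDominant α φ r (fun i => x i ω) (fun i => h i ω) n ≤ z} := by
  have hm := H.aemeasurable_nthDominant r hn
  have := Measure.isProbabilityMeasure_map hm
  rw [cdf_eq_real, map_measureReal_apply_of_aemeasurable hm measurableSet_Iic]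
  rfl

/-- The event `I_n ≤ z` lies between `I_n < z` and `I_n < t` for every `t > z`; letting `t` decrease
to `z`, continuity of the formula closes the gap. -/
theorem cdf_nthDominant_of_pos (H : IsInterferenceModel P lam α φ x h) (r : Plane) {n : ℕ}
    (hn : 1 ≤ n) {z : ℝ} (hz : 0 < z) :
    cdf (P.map fun ω => nthDominant α φ r (fun i => x i ω) (fun i => h i ω) n) z =
      poissonCdf n (meanCount P lam α φ h z⁻¹) := by
  have hα : 0 < 2 / α := by have := H.two_lt; positivity
  have hG : Tendsto (fun t => poissonCdf n (meanCount P lam α φ h t⁻¹)) (𝓝[>] z)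
      (𝓝 (poissonCdf n (meanCount P lam α φ h z⁻¹))) := by
    refine Tendsto.mono_left ?_ nhdsWithin_le_nhds
    refine ((continuous_poissonCdf n).tendsto _).comp ?_
    exact (((Real.continuous_rpow_const hα.le).tendsto _).comp
      (tendsto_inv₀ hz.ne')).const_mul _
  rw [H.cdf_nthDominant_eq r hn]
  refine le_antisymm (ge_of_tendsto hG ?_) ?_
  · filter_upwards [self_mem_nhdsWithin] with t ht
    rw [← H.prob_nthDominant_lt r hn (hz.trans ht)]
    refine measureReal_mono fun ω hω => ?_
    exact lt_of_le_of_lt (b := z) hω ht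
  · rw [← H.prob_nthDominant_lt r hn hz]
    refine measureReal_mono fun ω hω => ?_
    exact le_of_lt (b := z) hω

theorem cdf_nthDominant_of_nonpos (H : IsInterferenceModel P lam α φ x h) (r : Plane) {n : ℕ}
    (hn : 1 ≤ n) {z : ℝ} (hz : z ≤ 0) :
    cdf (P.map fun ω => nthDominant α φ r (fun i => x i ω) (fun i => h i ω) n) z = 0 := by
  rw [H.cdf_nthDominant_eq r hn, measureReal_eq_zero_iff, measure_eq_zero_iff_ae_notMem]
  filter_upwards [H.ae_isRegular r] with ω hω h
  exact absurd (hω.nthDominant_pos hn) (not_lt.2 (h.trans hz))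

end IsInterferenceModel

end Interference

theorem mainTheorem4 {Ω : Type*} [MeasurableSpace Ω] (P : Measure Ω) [IsProbabilityMeasure P]
    (lam α φ : ℝ) (hlam : 0 < lam) (hα : 2 < α) (hφ : 0 < φ) (hφ' : φ ≤ 2 * Real.pi)
    (r : Interference.Plane)
    (x : ℕ → Ω → Interference.Plane) (hx : Interference.IsHomogeneousPPP P lam x)
    (h : ℕ → Ω → ℝ) (hmeas : ∀ i, Measurable (h i)) (hindep : iIndepFun h P)
    (hident : ∀ i, IdentDistrib (h i) (h 0) P P) (hpos : ∀ i, ∀ᵐ ω ∂P, 0 < h i ω)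
    (hmoment : Integrable (fun ω => h 0 ω ^ (2 / α)) P)
    (hmark : IndepFun (fun ω i => x i ω) (fun ω i => h i ω) P) :
    (∀ᵐ ω ∂P, Interference.IsDescendingArrangement α φ r (fun i => x i ω) (fun i => h i ω)
      (Interference.nthDominant α φ r (fun i => x i ω) (fun i => h i ω))) ∧
    (∀ z : ℝ, 0 ≤ z →
      Interference.transformedIntensity P α φ r x h z =
        ENNReal.ofReal (φ * lam / 2 * (∫ ω, h 0 ω ^ (2 / α) ∂P) * z ^ (2 / α)) ∧
      ∀ k : ℕ,
        P {ω | Interference.transformedCount α φ r (fun i => x i ω) (fun i => h i ω) z = k} =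
          poissonMeasure (Interference.transformedIntensity P α φ r x h z).toNNReal {k}) ∧
    (∀ n : ℕ, 1 ≤ n →
      AEMeasurable
        (fun ω => Interference.nthDominant α φ r (fun i => x i ω) (fun i => h i ω) n) P ∧
      (∀ z : ℝ, 0 < z →
        cdf (P.map fun ω =>
            Interference.nthDominant α φ r (fun i => x i ω) (fun i => h i ω) n) z =
          Interference.upperGamma n (Interference.transformedIntensity P α φ r x h z⁻¹).toReal /
            Real.Gamma n) ∧
      (∀ z : ℝ, z ≤ 0 →
        cdf (P.map fun ω =>
            Interference.nthDominant α φ r (fun i => x i ω) (fun i => h i ω) n) z = 0)) := by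
  have H : Interference.IsInterferenceModel P lam α φ x h :=
    ⟨⟨hx, hmeas, hindep, hident, hmark⟩, hlam, hα, hφ, hφ', hpos, hmoment⟩
  refine ⟨(H.ae_isRegular r).mono fun ω hω => hω.isDescendingArrangement, fun z hz => ?_,
    fun n hn => ⟨H.aemeasurable_nthDominant r hn, fun z hz => ?_,
      fun z hz => H.cdf_nthDominant_of_nonpos r hn hz⟩⟩
  · refine ⟨H.transformedIntensity_eq r hz, fun k => ?_⟩
    rw [H.transformedIntensity_eq r hz]
    exact H.transformedCount_law r hz k
  · have hz' : 0 ≤ z⁻¹ := (inv_pos.2 hz).le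
    rw [H.cdf_nthDominant_of_pos r hn hz, H.transformedIntensity_eq r hz',
      ENNReal.toReal_ofReal (H.meanCount_nonneg hz'),
      Interference.upperGamma_div_gamma hn (H.meanCount_nonneg hz'), Interference.poissonCdf]
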